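/- Let $\mathcal H$ be a separable complex Hilbert space. For a compact operator $X$ on $\mathcal H$ let $s_1(X)\ge s_2(X)\ge\dots\ge 0$ be its singular values (the eigenvalues of $|X|=(X^*X)^{1/2}$ repeated according to multiplicity, continued by zeros if necessary), and $\sigma_n(X)=\sum_{j=1}^n s_j(X)$. Let $\mathcal C_1(\mathcal H)$ be the set of compact $X$ with $\|X\|_1:=\sum_j s_j(X)<\infty$ (trace-class operators), and let the Dixmier ideal $\mathcal C_{1,\infty}(\mathcal H)$ be the set of compact $X$ with $\sigma_n(X)=O(\ln n)$ as $n\to\infty$, with the norm $\|X\|_{1,\infty}=\sup_{n\ge1}\sigma_n(X)/(1+\ln n)$. A *dilation-invariant state* is a positive normalised continuous linear functional $\omega$ on the space $l^\infty(\mathbb N)$ of bounded real sequences such that $\omega(\eta)=\lim_n\eta_n$ for every convergent sequence $\eta$ of non-negative numbers, and $\omega(\eta_1,\eta_1,\eta_2,\eta_2,\dots)=\omega(\eta_1,\eta_2,\dots)$ for every $\eta\in l^\infty(\mathbb N)$. Given such an $\omega$, put $\mathrm{Tr}_\omega(X)=\omega\big(\{\sigma_n(X)/(1+\ln n)\}_{n\ge1}\big)$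 for $X\ge0$ in $\mathcal C_{1,\infty}(\mathcal H)$, $\mathrm{Tr}_\omega(X)=\mathrm{Tr}_\omega(X_+)-\mathrm{Tr}_\omega(X_-)$ for $X=X^*$ in $\mathcal C_{1,\infty}(\mathcal H)$ with positive and negative parts $X_\pm$, and $\mathrm{Tr}_\omega(Z)=\mathrm{Tr}_\omega(\mathrm{Re}\,Z)+i\,\mathrm{Tr}_\omega(\mathrm{Im}\,Z)$ for arbitrary $Z\in\mathcal C_{1,\infty}(\mathcal H)$ (the *Dixmier trace*). Then the following hold. 1. Dilation-invariant states exist. 2. For positive compact operators $X,Y$ and all $n$: $\sigma_n(X+Y)\le\sigma_n(X)+\sigma_n(Y)\le\sigma_{2n}(X+Y)$. 3. $\mathcal C_{1,\infty}(\mathcal H)$ is a linear space, it contains $ZB$ and $BZ$ for $Z\in\mathcal C_{1,\infty}(\mathcal H)$ and $B$ bounded, it contains $\mathrm{Re}\,Z$ and $\mathrm{Im}\,Z$ for each of its members $Z$ and $X_\pm$ for each of its self-adjoint members $X$, and $\mathcal C_1(\mathcal H)\subset\mathcal C_{1,\infty}(\mathcal H)$. 4. For every dilation-invariant state $\omega$: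 on positive operators in $\mathcal C_{1,\infty}(\mathcal H)$ the extended functional $\mathrm{Tr}_\omega$ agrees with the defining formula and is non-negative, additive and positively homogeneous, and $\mathrm{Tr}_\omega$ is complex-linear on $\mathcal C_{1,\infty}(\mathcal H)$. Moreover: (a) $\mathrm{Tr}_\omega(ZB)=\mathrm{Tr}_\omega(BZ)$ for every bounded operator $B$ on $\mathcal H$ and every $Z\in\mathcal C_{1,\infty}(\mathcal H)$. (b) $\mathrm{Tr}_\omega(C)=0$ for every $C\in\mathcal C_1(\mathcal H)$; and $\mathcal C_1(\mathcal H)$ is the closure of the finite-rank operators for $\|\cdot\|_1$, i.e. $C\in\mathcal C_1(\mathcal H)$ if and only if for every $\varepsilon>0$ there is a finite-rank $F$ with $C-F\in\mathcal C_1(\mathcal H)$ and $\|C-F\|_1<\varepsilon$. (c) $|\mathrm{Tr}_\omega(Z)|\le\|Z\|_{1,\infty}$ for every $Z\in\mathcal C_{1,\infty}(\mathcal H)$, and $\mathrm{Tr}_\omega:\mathcal C_{1,\infty}(\mathcal H)\to\mathbb C$ is continuous in the norm $\|\cdot\|_{1,\infty}$. -/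

import Mathlib

open Filter Topology Asymptotics
open scoped ENNReal ComplexStarModule

noncomputable section

namespace Dixmier

/-! ### Bounded sequences and dilation-invariant states -/

/-- The Banach space of bounded real sequences. The entry with index `n : ℕ` stands for the
member number `n + 1` of a sequence `(η₁, η₂, …)`. -/
abbrev LInfty : Type := lp (fun _ : ℕ => ℝ) ∞

/-- The dilation `(η₁, η₂, η₃, …) ↦ (η₁, η₁, η₂, η₂, η₃, η₃, …)`. -/
def dilation (η : LInfty) : LInfty :=
  ⟨fun n => η (n / 2), by
    refine memℓp_infty ⟨‖η‖, ?_⟩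
    rintro _ ⟨n, rfl⟩
    exact lp.norm_apply_le_norm ENNReal.top_ne_zero η (n / 2)⟩

/-- A state on the bounded sequences (a positive normalised continuous linear functional) that
agrees with the ordinary limit on convergent non-negative sequences and is invariant under the
dilation. -/
structure IsDilationInvariantState (ω : StrongDual ℝ LInfty) : Prop where
  nonneg : ∀ η : LInfty, (∀ n, 0 ≤ η n) → 0 ≤ ω η
  normalised : ∀ η : LInfty, (∀ n, η n = 1) → ω η = 1
  eq_lim : ∀ (η : LInfty) (a : ℝ), (∀ n, 0 ≤ η n) → Tendsto (fun n => η n) atTop (𝓝 a) → ω η = a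
  dilation_eq : ∀ η : LInfty, ω (dilation η) = ω η

/-! ### Singular values, the trace class and the Dixmier ideal -/

section Operators

variable {H : Type*} [NormedAddCommGroup H] [InnerProductSpace ℂ H] [CompleteSpace H]

/-- The span of all eigenvectors of `|T| = (T* T)^{1/2}` with eigenvalue greater than `t`. Its
dimension is the number of eigenvalues of `|T|` greater than `t`, counted with multiplicity. -/
def eigenspaceAbove (T : H →L[ℂ] H) (t : ℝ) : Submodule ℂ H :=
  ⨆ (μ : ℝ) (_ : t < μ), Module.End.eigenspace (CFC.abs T : H →L[ℂ] H).toLinearMap (μ : ℂ)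

/-- Singular values of a compact operator: the eigenvalues of `|T|` in non-increasing order,
repeated according to multiplicity, continued by zeros if there are only finitely many non-zero
ones. They are indexed from zero, so `singularValue T n` is `s_{n+1}(T)`: the least `t ≥ 0` such
that at most `n` eigenvalues of `|T|`, counted with multiplicity, exceed `t`. -/
def singularValue (T : H →L[ℂ] H) (n : ℕ) : ℝ :=
  sInf {t : ℝ | 0 ≤ t ∧ Module.rank ℂ (eigenspaceAbove T t) ≤ (n : Cardinal)}

/-- The partial sum `σ_n(T) = s₁(T) + … + s_n(T)`. -/
def sigma (n : ℕ) (T : H →L[ℂ] H) : ℝ := ∑ j ∈ Finset.range n, singularValue T j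

/-- Trace-class operators: compact operators with summable singular values. -/
def IsTraceClass (T : H →L[ℂ] H) : Prop :=
  IsCompactOperator T ∧ Summable (singularValue T)

/-- The trace norm `‖T‖₁ = ∑ s_j(T)` of a trace-class operator. -/
def traceNorm (T : H →L[ℂ] H) : ℝ := ∑' j, singularValue T j

/-- Operators of finite rank. -/
def IsFiniteRank (T : H →L[ℂ] H) : Prop := FiniteDimensional ℂ T.range

/-- The Dixmier ideal `C_{1,∞}(H)`: compact operators with `σ_n(T) = O(ln n)`. -/
def MemDixmierIdeal (T : H →L[ℂ] H) : Prop :=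
  IsCompactOperator T ∧ (fun n : ℕ => sigma n T) =O[atTop] fun n : ℕ => Real.log n

/-- Member number `n + 1` of the sequence `σ_n(T) / (1 + ln n)`, `n ≥ 1`. -/
def meanFun (T : H →L[ℂ] H) (n : ℕ) : ℝ := sigma (n + 1) T / (1 + Real.log ((n + 1 : ℕ) : ℝ))

/-- The norm `‖T‖_{1,∞} = sup_{n ≥ 1} σ_n(T) / (1 + ln n)` of the Dixmier ideal. -/
def dixmierNorm (T : H →L[ℂ] H) : ℝ := ⨆ n : ℕ, meanFun T n

/-- For operators in the Dixmier ideal the sequence `σ_n(T) / (1 + ln n)` is bounded. -/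
theorem MemDixmierIdeal.memℓp_meanFun {T : H →L[ℂ] H} (hT : MemDixmierIdeal T) :
    Memℓp (meanFun T) ∞ := by
  have h1 : (fun n : ℕ => sigma (n + 1) T) =O[atTop]
      fun n : ℕ => Real.log ((n + 1 : ℕ) : ℝ) :=
    hT.2.comp_tendsto (tendsto_add_atTop_nat 1)
  obtain ⟨C, hC⟩ := h1.bound
  have h2 : (meanFun T) =O[atTop] fun _ : ℕ => (1 : ℝ) := by
    refine IsBigO.of_bound |C| ?_
    filter_upwards [hC] with n hn
    have hl : 0 ≤ Real.log ((n + 1 : ℕ) : ℝ) := Real.log_natCast_nonneg _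
    have hp : 0 < 1 + Real.log ((n + 1 : ℕ) : ℝ) := by linarith
    rw [meanFun, norm_div, norm_one, mul_one, Real.norm_of_nonneg hp.le, div_le_iff₀ hp]
    rw [Real.norm_of_nonneg hl] at hn
    have := mul_le_mul_of_nonneg_right (le_abs_self C) hl
    nlinarith [abs_nonneg C]
  obtain ⟨K, -, hK⟩ := bound_of_isBigO_nat_atTop h2
  refine memℓp_infty ⟨K, ?_⟩
  rintro _ ⟨n, rfl⟩
  simpa using hK (x := n) one_ne_zero

open Classical in
/-- The sequence `σ_n(T) / (1 + ln n)`, `n ≥ 1`, as a bounded sequence. It has this meaning on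
the Dixmier ideal; unbounded sequences are replaced by zero. -/
def mean (T : H →L[ℂ] H) : LInfty :=
  if h : Memℓp (meanFun T) ∞ then ⟨meanFun T, h⟩ else 0

theorem MemDixmierIdeal.mean_apply {T : H →L[ℂ] H} (hT : MemDixmierIdeal T) (n : ℕ) :
    mean T n = sigma (n + 1) T / (1 + Real.log ((n + 1 : ℕ) : ℝ)) := by
  rw [mean, dif_pos hT.memℓp_meanFun]
  rfl

/-! ### The Dixmier trace -/

/-- The Dixmier trace on the positive cone of the Dixmier ideal. -/
def dixmierTracePos (ω : StrongDual ℝ LInfty) (X : H →L[ℂ] H) : ℝ := ω (mean X)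

/-- The Dixmier trace on self-adjoint operators `X = X₊ - X₋` of the Dixmier ideal. -/
def dixmierTraceSA (ω : StrongDual ℝ LInfty) (X : H →L[ℂ] H) : ℝ :=
  dixmierTracePos ω X⁺ - dixmierTracePos ω X⁻

/-- The Dixmier trace `Tr_ω(Z) = Tr_ω(Re Z) + i Tr_ω(Im Z)`. -/
def dixmierTrace (ω : StrongDual ℝ LInfty) (Z : H →L[ℂ] H) : ℂ :=
  (dixmierTraceSA ω (ℜ Z : H →L[ℂ] H) : ℂ) + Complex.I * (dixmierTraceSA ω (ℑ Z : H →L[ℂ] H) : ℂ)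

end Operators

end Dixmier

end

/-! # Singular values, Ky Fan's inequalities and the Dixmier trace -/

/-! Everything is deduced from inequalities for the sums `sigma n`. A positive compact operator is
diagonalised by repeatedly splitting off a top eigenvector from an orthogonal complement. Applied to
`|T|` this gives a singular system, and `IsSingularSystem.eq_singularValue` identifies its numbers
with the singular values defined by ranks. Ky Fan's principle follows: `sigma n T` bounds the sum of
`|⟨g i, T (f i)⟩|` over `i < n` for all orthogonal families `f`, `g` of vectors of norm at most one,
and is attained. It yields subadditivity and invariance under adjoints; with the minimax bound it
yields the ideal property. For positive `X`, `Y`, testing `X + Y` on the span of the first `n`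
eigenvectors of each, of dimension at most `2n`, gives the second Ky Fan inequality.

The heart of the matter is additivity on the positive cone, `MemDixmierIdeal.map_mean_add`. Write
`a` for the sequence of means of `X + Y`. Since `ln (2n) = ln n + ln 2`, the two inequalities place
the sum of the means of `X` and `Y` between `a_n` and `a_{2n}`, up to a null sequence. The dilation
of `(a_{2n})` is `(a_2, a_2, a_4, a_4, …)`, which exceeds `a` by at most a null sequence, so an
invariant state closes the gap.

Additivity makes the extension by positive and negative parts linear. The trace property then
follows from unitary invariance, because unitaries span the bounded operators. On the trace class
the means are null, and the norm estimate follows by rotating the value to the positive axis.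
Invariant states arise as ultrafilter limits of Cesàro means along powers of two. -/

namespace Dixmier

section

variable {H : Type*} [NormedAddCommGroup H] [InnerProductSpace ℂ H] [CompleteSpace H]

/-! ### Compactness -/

/-- A finite `δ`-net of the `T`-image of the unit ball can be centred at points `T z` with `z` in
the ball; the points `S z` then form an `ε`-net. Differences of points of the ball have norm below
2, hence that bound in the hypothesis. -/
theorem isCompactOperator_of_forall_norm_lt {S T : H →L[ℂ] H} (hT : IsCompactOperator T)
    (h : ∀ ε > 0, ∃ δ > 0, ∀ x, ‖x‖ < 2 → ‖T x‖ < δ → ‖S x‖ < ε) : IsCompactOperator S := by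
  have h1 := (isCompactOperator_iff_isCompact_closure_image_ball (T : H →ₗ[ℂ] H)
    one_pos).1 hT
  refine (isCompactOperator_iff_isCompact_closure_image_ball (S : H →ₗ[ℂ] H) one_pos).2 ?_
  have h2 : TotallyBounded (T '' Metric.ball 0 1) := h1.totallyBounded.subset subset_closure
  refine isCompact_iff_totallyBounded_isComplete.2
    ⟨TotallyBounded.closure (s := S '' Metric.ball 0 1) ?_, isClosed_closure.isComplete⟩
  rw [Metric.totallyBounded_iff]
  intro ε hε
  obtain ⟨δ, hδ, hδε⟩ := h ε hε
  obtain ⟨t, hts, htf, ht⟩ := Metric.finite_approx_of_totallyBounded h2 δ hδ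
  obtain ⟨u, hus, huf, rfl⟩ := Set.exists_subset_image_finite_and.1 ⟨t, hts, htf, rfl⟩
  refine ⟨S '' u, huf.image _, ?_⟩
  rintro _ ⟨x, hx, rfl⟩
  obtain ⟨y, hy, hxy⟩ := Set.mem_iUnion₂.1 (ht ⟨x, hx, rfl⟩)
  obtain ⟨z, hz, rfl⟩ := hy
  refine Set.mem_iUnion₂.2 ⟨S z, ⟨z, hz, rfl⟩, ?_⟩
  rw [Metric.mem_ball, dist_eq_norm, ← map_sub] at hxy ⊢
  refine hδε _ ((norm_sub_le _ _).trans_lt ?_) hxy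
  have := mem_ball_zero_iff.1 hx
  have := mem_ball_zero_iff.1 (hus hz)
  linarith

theorem isCompactOperator_of_norm_le {S T : H →L[ℂ] H} (hT : IsCompactOperator T)
    {c : ℝ} (hc : 0 ≤ c) (h : ∀ x, ‖S x‖ ≤ c * ‖T x‖) : IsCompactOperator S := by
  refine isCompactOperator_of_forall_norm_lt hT fun ε hε => ⟨ε / (c + 1), by positivity,
    fun x _ hx => (h x).trans_lt ?_⟩
  rw [lt_div_iff₀ (by positivity)] at hx
  nlinarith [norm_nonneg (T x)]

/-- Since `‖T* x‖² = ⟨x, T T* x⟩ ≤ ‖T T* x‖ ‖x‖`, smallness of the compact operator `T T*` at `x`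
controls `T*` at `x`. -/
theorem isCompactOperator_adjoint {T : H →L[ℂ] H} (hT : IsCompactOperator T) :
    IsCompactOperator (star T : H →L[ℂ] H) := by
  refine isCompactOperator_of_forall_norm_lt (T := T * star T) (hT.comp_clm (star T))
    fun ε hε => ⟨ε ^ 2 / 2, by positivity, fun x hx hTx => ?_⟩
  have h1 : ‖(star T : H →L[ℂ] H) x‖ ^ 2 ≤ ‖(T * star T) x‖ * ‖x‖ := by
    rw [← inner_self_eq_norm_sq (𝕜 := ℂ), ContinuousLinearMap.star_eq_adjoint,
      ContinuousLinearMap.adjoint_inner_right]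
    exact (RCLike.re_le_norm _).trans (norm_inner_le_norm _ _)
  refine lt_of_pow_lt_pow_left₀ 2 hε.le (h1.trans_lt ?_)
  nlinarith [norm_nonneg ((T * star T) x), norm_nonneg x]

theorem inner_abs_apply (T : H →L[ℂ] H) (x y : H) :
    inner ℂ (CFC.abs T x) (CFC.abs T y) = inner ℂ (T x) (T y) := by
  have hs : IsSelfAdjoint (CFC.abs T) := (CFC.abs_nonneg T).isSelfAdjoint
  rw [← ContinuousLinearMap.adjoint_inner_right T, ← ContinuousLinearMap.adjoint_inner_right,
    hs.adjoint_eq]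
  have := congrArg (fun B : H →L[ℂ] H => B y) (CFC.abs_mul_abs T)
  simp only [mul_apply_eq_comp, ContinuousLinearMap.star_eq_adjoint] at this
  rw [this]

theorem norm_abs_apply (T : H →L[ℂ] H) (x : H) : ‖(CFC.abs T) x‖ = ‖T x‖ := by
  have h1 := inner_abs_apply T x x
  rw [inner_self_eq_norm_sq_to_K, inner_self_eq_norm_sq_to_K] at h1
  have h2 : ‖(CFC.abs T) x‖ ^ 2 = ‖T x‖ ^ 2 := by exact_mod_cast h1
  exact (sq_eq_sq₀ (norm_nonneg _) (norm_nonneg _)).1 h2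

theorem isCompactOperator_abs {T : H →L[ℂ] H} (hT : IsCompactOperator T) :
    IsCompactOperator (CFC.abs T : H →L[ℂ] H) :=
  isCompactOperator_of_norm_le hT (zero_le_one' ℝ) fun x => by rw [norm_abs_apply, one_mul]

/-! ### Diagonalisation of positive compact operators -/

/-- On the orthogonal complement of an invariant subspace a positive compact operator has an
eigenvector whose eigenvalue is the norm of the restriction. -/
theorem exists_top_eigenvector {A : H →L[ℂ] H} (hA : 0 ≤ A) (hc : IsCompactOperator A)
    {K : Submodule ℂ H} (hK : FiniteDimensional ℂ K) (hinv : ∀ x ∈ K, A x ∈ K) :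
    ∃ (v : H) (μ : ℝ), 0 ≤ μ ∧ v ∈ Kᗮ ∧ A v = (μ : ℂ) • v ∧ (∀ x ∈ Kᗮ, ‖A x‖ ≤ μ * ‖x‖) ∧
      (μ ≠ 0 → ‖v‖ = 1) ∧ (μ = 0 → v = 0) := by
  have hs : IsSelfAdjoint A := hA.isSelfAdjoint
  have hinv' : ∀ x ∈ Kᗮ, A x ∈ Kᗮ := by
    intro x hx y hy
    rw [← hs.adjoint_eq, ContinuousLinearMap.adjoint_inner_right]
    exact hx _ (hinv y hy)
  -- The compression `P A P` is positive and compact on all of `H`, so its norm lies in the spectrum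
  -- and, if non-zero, is an eigenvalue. An eigenvector for it lies in the range of `P`.
  set P : H →L[ℂ] H := Kᗮ.starProjection with hP
  set B : H →L[ℂ] H := P * A * P with hB
  have hPs : star P = P := isSelfAdjoint_starProjection _
  have hB0 : 0 ≤ B := by
    have := star_left_conjugate_nonneg hA P
    rwa [hPs] at this
  have hBc : IsCompactOperator B := (hc.clm_comp P).comp_clm P
  have hPx : ∀ x ∈ Kᗮ, P x = x := fun x hx => Submodule.starProjection_eq_self_iff.2 hx
  have hBx : ∀ x ∈ Kᗮ, B x = A x := fun x hx => by
    simp only [hB, mul_apply_eq_comp, hPx x hx, hPx _ (hinv' x hx)]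
  have hbd : ∀ x ∈ Kᗮ, ‖A x‖ ≤ ‖B‖ * ‖x‖ := fun x hx => by
    rw [← hBx x hx]; exact B.le_opNorm x
  by_cases h0 : ‖B‖ = 0
  · exact ⟨0, 0, le_rfl, zero_mem _, by simp, fun x hx => by simpa [h0] using hbd x hx,
      fun h => absurd rfl h, fun _ => rfl⟩
  · have : Nontrivial (H →L[ℂ] H) := ⟨B, 0, fun h => h0 (by rw [h, norm_zero])⟩
    have hsp : ((‖B‖ : ℝ) : ℂ) ∈ spectrum ℂ B :=
      spectrum.algebraMap_mem ℂ (CStarAlgebra.norm_mem_spectrum_of_nonneg (a := B) hB0)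
    have hne : ((‖B‖ : ℝ) : ℂ) ≠ 0 := by exact_mod_cast h0
    obtain ⟨w, hw⟩ := ((hBc.hasEigenvalue_iff_mem_spectrum hne).2 hsp).exists_hasEigenvector
    have hw1 : B w = ((‖B‖ : ℝ) : ℂ) • w := hw.apply_eq_smul
    have hw0 : w ≠ 0 := hw.2
    have hwK : w ∈ Kᗮ := by
      have : w = ((‖B‖ : ℝ) : ℂ)⁻¹ • B w := by rw [hw1, inv_smul_smul₀ hne]
      rw [this]
      exact Submodule.smul_mem _ _ (Submodule.starProjection_apply_mem _ _)
    refine ⟨((‖w‖ : ℝ) : ℂ)⁻¹ • w, ‖B‖, norm_nonneg _, Submodule.smul_mem _ _ hwK, ?_, hbd, ?_,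
      fun h => absurd h h0⟩
    · rw [map_smul, ← hBx w hwK, hw1, smul_comm]
    · intro _
      rw [norm_smul, norm_inv, Complex.norm_real, norm_norm, inv_mul_cancel₀ (norm_ne_zero_iff.2 hw0)]

/-- A sequence of mutually orthogonal eigenvectors of `|T|` for the singular values `s`; each
vector is normalised or, if its singular value vanishes, zero. -/
structure IsSingularSystem (T : H →L[ℂ] H) (s : ℕ → ℝ) (e : ℕ → H) : Prop where
  nonneg : ∀ n, 0 ≤ s n
  orthogonal : ∀ i j, i ≠ j → inner ℂ (e i) (e j) = 0
  norm_eq_one : ∀ n, s n ≠ 0 → ‖e n‖ = 1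
  eq_zero : ∀ n, s n = 0 → e n = 0
  apply_eq : ∀ n, CFC.abs T (e n) = (s n : ℂ) • e n
  norm_le : ∀ n x, (∀ j < n, inner ℂ (e j) x = 0) → ‖T x‖ ≤ s n * ‖x‖

theorem exists_eigenvalues_isSingularSystem {T : H →L[ℂ] H} (hT : IsCompactOperator T) :
    ∃ s e, IsSingularSystem T s e := by
  have hc := isCompactOperator_abs hT
  have key : ∀ K : Submodule ℂ H, (FiniteDimensional ℂ K ∧ ∀ x ∈ K, CFC.abs T x ∈ K) →
      ∃ (v : H) (μ : ℝ), 0 ≤ μ ∧ v ∈ Kᗮ ∧ CFC.abs T v = (μ : ℂ) • v ∧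
        (∀ x ∈ Kᗮ, ‖CFC.abs T x‖ ≤ μ * ‖x‖) ∧ (μ ≠ 0 → ‖v‖ = 1) ∧ (μ = 0 → v = 0) :=
    fun K hK => exists_top_eigenvector (CFC.abs_nonneg T) hc hK.1 hK.2
  choose! f μ hμ0 hfK hfe hbd hone hzero using key
  -- `K n` is spanned by the first `n` vectors chosen; the next is a top eigenvector on its
  -- complement. If the operator vanishes there, the zero vector is chosen and the recursion
  -- stabilises.
  let K : ℕ → Submodule ℂ H := fun n => Nat.rec (motive := fun _ => Submodule ℂ H) ⊥ (fun _ L => L ⊔ Submodule.span ℂ {f L}) n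
  have hKs : ∀ n, K (n + 1) = K n ⊔ Submodule.span ℂ {f (K n)} := fun n => rfl
  have hK : ∀ n : ℕ, FiniteDimensional ℂ (K n : Submodule ℂ H) ∧ ∀ x ∈ K n, CFC.abs T x ∈ K n := by
    intro n
    induction n with
    | zero =>
      refine ⟨inferInstanceAs (FiniteDimensional ℂ (⊥ : Submodule ℂ H)), fun x hx => ?_⟩
      have hx : x = 0 := hx
      rw [hx, map_zero]; exact zero_mem _
    | succ n ih =>
      have := ih.1
      rw [hKs]
      refine ⟨inferInstance, fun x hx => ?_⟩
      obtain ⟨y, hy, z, hz, rfl⟩ := Submodule.mem_sup.1 hx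
      obtain ⟨c, rfl⟩ := Submodule.mem_span_singleton.1 hz
      rw [map_add, map_smul, hfe _ ih]
      exact add_mem (Submodule.mem_sup_left (ih.2 y hy)) (Submodule.mem_sup_right
        (Submodule.smul_mem _ _ (Submodule.smul_mem _ _ (Submodule.mem_span_singleton_self _))))
  have hmono : Monotone K := monotone_nat_of_le_succ fun n => by rw [hKs]; exact le_sup_left
  have hmem : ∀ i j, i < j → f (K i) ∈ K j := fun i j hij => hmono (Nat.succ_le_of_lt hij) (by
    rw [Nat.succ_eq_add_one, hKs]
    exact Submodule.mem_sup_right (Submodule.mem_span_singleton_self _))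
  have horth : ∀ i j, i < j → inner ℂ (f (K i)) (f (K j)) = 0 := fun i j hij =>
    hfK _ (hK j) _ (hmem i j hij)
  have hperp : ∀ x n, (∀ j < n, inner ℂ (f (K j)) x = 0) → x ∈ (K n)ᗮ := by
    intro x n
    induction n with
    | zero => intro _ y hy; rw [show y = 0 from hy, inner_zero_left]
    | succ n ih =>
      intro h w hw
      rw [hKs] at hw
      obtain ⟨y, hy, z, hz, rfl⟩ := Submodule.mem_sup.1 hw
      obtain ⟨c, rfl⟩ := Submodule.mem_span_singleton.1 hz
      rw [inner_add_left, inner_smul_left, h n (Nat.lt_succ_self n),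
        ih (fun j hj => h j (hj.trans (Nat.lt_succ_self n))) y hy, mul_zero, add_zero]
  refine ⟨fun n => μ (K n), fun n => f (K n), fun n => hμ0 _ (hK n), fun i j hij => ?_,
    fun n => hone _ (hK n), fun n => hzero _ (hK n), fun n => hfe _ (hK n), fun n x hx => ?_⟩
  · rcases lt_or_gt_of_ne hij with h | h
    · exact horth i j h
    · rw [← inner_conj_symm, horth j i h, map_zero]
  · rw [← norm_abs_apply]
    exact hbd _ (hK n) x (hperp x n hx)

/-! ### Singular systems compute the singular values. -/

theorem IsSingularSystem.inner_sub_sum {T : H →L[ℂ] H} {s : ℕ → ℝ} {e : ℕ → H}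
    (h : IsSingularSystem T s e) {n j : ℕ} (hj : j < n) (x : H) :
    inner ℂ (e j) (x - ∑ i ∈ Finset.range n, inner ℂ (e i) x • e i) = 0 := by
  rw [inner_sub_right, inner_sum, Finset.sum_eq_single j]
  · rw [inner_smul_right]
    by_cases h0 : s j = 0
    · simp [h.eq_zero j h0]
    · rw [inner_self_eq_norm_sq_to_K, h.norm_eq_one j h0]; simp
  · intro i _ hij
    rw [inner_smul_right, h.orthogonal j i hij.symm, mul_zero]
  · intro hn; exact absurd (Finset.mem_range.2 hj) hn

/-- Removing from an eigenvector its components along the first `n` vectors leaves `q` with `|T| q =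
μ q`, because a component along `e i` survives only if `s i = μ`. But `|T|` is bounded by `s n < μ`
on the complement, so `q = 0`. -/
theorem IsSingularSystem.eigenspaceAbove_le {T : H →L[ℂ] H} {s : ℕ → ℝ} {e : ℕ → H}
    (h : IsSingularSystem T s e) {n : ℕ} {t : ℝ} (ht : s n ≤ t) :
    eigenspaceAbove T t ≤ Submodule.span ℂ (Set.range fun i : Fin n => e i) := by
  refine iSup₂_le fun μ hμ x hx => ?_
  rw [Module.End.mem_eigenspace_iff] at hx
  have hx : CFC.abs T x = (μ : ℂ) • x := hx
  have hs : IsSelfAdjoint (CFC.abs T) := (CFC.abs_nonneg T).isSelfAdjoint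
  have hp : ∑ i ∈ Finset.range n, inner ℂ (e i) x • e i ∈
      Submodule.span ℂ (Set.range fun i : Fin n => e i) :=
    Submodule.sum_mem _ fun i hi => Submodule.smul_mem _ _
      (Submodule.subset_span ⟨⟨i, Finset.mem_range.1 hi⟩, rfl⟩)
  set q := x - ∑ i ∈ Finset.range n, inner ℂ (e i) x • e i with hq
  have hAq : CFC.abs T q = (μ : ℂ) • q := by
    rw [hq, map_sub, hx, smul_sub, map_sum, Finset.smul_sum]
    congr 1
    refine Finset.sum_congr rfl fun i _ => ?_
    rw [map_smul, h.apply_eq]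
    have h1 : (s i : ℂ) * inner ℂ (e i) x = (μ : ℂ) * inner ℂ (e i) x := by
      have h2 : inner ℂ (CFC.abs T (e i)) x = inner ℂ (e i) (CFC.abs T x) := by
        rw [← ContinuousLinearMap.adjoint_inner_right, hs.adjoint_eq]
      rwa [h.apply_eq, hx, inner_smul_left, inner_smul_right, Complex.conj_ofReal] at h2
    rw [smul_smul, smul_smul, ← h1, mul_comm]
  have h3 := h.norm_le n q fun j hj => h.inner_sub_sum hj x
  rw [← norm_abs_apply, hAq, norm_smul, Complex.norm_real, Real.norm_eq_abs] at h3
  have hq0 : q = 0 := by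
    by_contra hne
    have : 0 < ‖q‖ := norm_pos_iff.2 hne
    have := le_of_mul_le_mul_right h3 this
    linarith [le_abs_self μ]
  rwa [sub_eq_zero.1 hq0]

theorem IsSingularSystem.antitone {T : H →L[ℂ] H} {s : ℕ → ℝ} {e : ℕ → H}
    (h : IsSingularSystem T s e) : Antitone s := by
  refine antitone_nat_of_succ_le fun n => ?_
  by_cases h0 : s (n + 1) = 0
  · rw [h0]; exact h.nonneg n
  · have := h.norm_le n (e (n + 1)) fun j hj => h.orthogonal _ _ (by omega)
    rwa [← norm_abs_apply, h.apply_eq, norm_smul, h.norm_eq_one _ h0, mul_one, mul_one,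
      Complex.norm_real, Real.norm_of_nonneg (h.nonneg _)] at this

theorem IsSingularSystem.orthonormal {T : H →L[ℂ] H} {s : ℕ → ℝ} {e : ℕ → H}
    (h : IsSingularSystem T s e) {n : ℕ} (hn : s n ≠ 0) :
    Orthonormal ℂ fun i : Fin (n + 1) => e i := by
  refine ⟨fun i => h.norm_eq_one _ ?_, fun i j hij => h.orthogonal _ _ fun hh => hij (Fin.ext hh)⟩
  have := h.antitone (Nat.lt_succ_iff.1 i.2)
  have := (h.nonneg n).lt_of_ne' hn
  linarith

theorem IsSingularSystem.rank_le_iff {T : H →L[ℂ] H} {s : ℕ → ℝ} {e : ℕ → H}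
    (h : IsSingularSystem T s e) (n : ℕ) {t : ℝ} (ht : 0 ≤ t) :
    Module.rank ℂ (eigenspaceAbove T t) ≤ (n : Cardinal) ↔ s n ≤ t := by
  constructor
  · intro hr
    by_contra! hlt
    -- If `s n > t`, then `e 0, …, e n` are `n + 1` independent vectors in the eigenspaces above
    -- `t`.
    have hli := (h.orthonormal (ht.trans_lt hlt).ne').linearIndependent
    have hsub : Submodule.span ℂ (Set.range fun i : Fin (n + 1) => e i) ≤ eigenspaceAbove T t := by
      rw [Submodule.span_le]
      rintro _ ⟨i, rfl⟩
      have h1 : t < s i := hlt.trans_le (h.antitone (Nat.lt_succ_iff.1 i.2))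
      refine Submodule.mem_iSup_of_mem (s i) (Submodule.mem_iSup_of_mem h1 ?_)
      rw [Module.End.mem_eigenspace_iff]
      exact h.apply_eq i
    have h2 := (Submodule.rank_mono hsub).trans hr
    rw [rank_span hli] at h2
    have h3 := Cardinal.lift_le.{0}.2 h2
    rw [Cardinal.mk_range_eq_of_injective hli.injective, Cardinal.mk_fin] at h3
    have : n + 1 ≤ n := by simp at h3
    omega
  · intro hle
    refine (Submodule.rank_mono (h.eigenspaceAbove_le hle)).trans ((rank_span_le _).trans ?_)
    simpa using Cardinal.mk_range_le_lift (f := fun i : Fin n => e i)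

theorem IsSingularSystem.eq_singularValue {T : H →L[ℂ] H} {s : ℕ → ℝ} {e : ℕ → H}
    (h : IsSingularSystem T s e) : s = singularValue T := by
  funext n
  have : {t : ℝ | 0 ≤ t ∧ Module.rank ℂ (eigenspaceAbove T t) ≤ (n : Cardinal)} = Set.Ici (s n) := by
    ext t
    simp only [Set.mem_ofPred_eq, Set.mem_Ici]
    exact ⟨fun ht => (h.rank_le_iff n ht.1).1 ht.2, fun ht =>
      ⟨(h.nonneg n).trans ht, (h.rank_le_iff n ((h.nonneg n).trans ht)).2 ht⟩⟩
  rw [singularValue, this, csInf_Ici]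

theorem exists_isSingularSystem {T : H →L[ℂ] H} (hT : IsCompactOperator T) :
    ∃ e, IsSingularSystem T (singularValue T) e := by
  obtain ⟨s, e, h⟩ := exists_eigenvalues_isSingularSystem hT
  exact ⟨e, h.eq_singularValue ▸ h⟩

end

section

variable {H : Type*} [NormedAddCommGroup H] [InnerProductSpace ℂ H]

/-! ### Orthogonal families of vectors of norm at most one -/

theorem norm_sq_sum_of_orthogonal {ι : Type*} (s : Finset ι) (v : ι → H)
    (h : ∀ i j, i ≠ j → inner ℂ (v i) (v j) = 0) :
    ‖∑ i ∈ s, v i‖ ^ 2 = ∑ i ∈ s, ‖v i‖ ^ 2 := by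
  classical
  induction s using Finset.induction_on with
  | empty => simp
  | insert a s ha ih =>
    have h0 : inner ℂ (v a) (∑ i ∈ s, v i) = 0 := by
      rw [inner_sum]
      exact Finset.sum_eq_zero fun i hi => h _ _ fun hh => ha (hh ▸ hi)
    rw [Finset.sum_insert ha, Finset.sum_insert ha, ← ih, norm_add_sq (𝕜 := ℂ), h0]
    simp

/-- Mutually orthogonal vectors of norm at most one. -/
structure IsSuborthonormal (f : ℕ → H) : Prop where
  orthogonal : ∀ i j, i ≠ j → inner ℂ (f i) (f j) = 0
  norm_le_one : ∀ i, ‖f i‖ ≤ 1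

/-- With `S` the left side and `y` the sum of `⟨f i, x⟩ f i`, one has `⟨y, x⟩ = S` and `‖y‖² ≤ S`;
expand `‖y - x‖² ≥ 0`. Norms below one, in particular zero vectors, do no harm. -/
theorem IsSuborthonormal.bessel {f : ℕ → H} (hf : IsSuborthonormal f) (s : Finset ℕ) (x : H) :
    ∑ i ∈ s, ‖inner ℂ (f i) x‖ ^ 2 ≤ ‖x‖ ^ 2 := by
  set y := ∑ i ∈ s, inner ℂ (f i) x • f i with hy
  have h1 : inner ℂ y x = ((∑ i ∈ s, ‖inner ℂ (f i) x‖ ^ 2 : ℝ) : ℂ) := by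
    rw [hy, sum_inner]
    push_cast
    refine Finset.sum_congr rfl fun i _ => ?_
    rw [inner_smul_left, RCLike.conj_mul]
    rfl
  have h2 : ‖y‖ ^ 2 ≤ ∑ i ∈ s, ‖inner ℂ (f i) x‖ ^ 2 := by
    rw [hy, norm_sq_sum_of_orthogonal]
    · refine Finset.sum_le_sum fun i _ => ?_
      rw [norm_smul, mul_pow]
      exact mul_le_of_le_one_right (sq_nonneg _) (pow_le_one₀ (norm_nonneg _) (hf.norm_le_one i))
    · intro i j hij
      rw [inner_smul_left, inner_smul_right, hf.orthogonal i j hij, mul_zero, mul_zero]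
  have h3 := norm_sub_sq (𝕜 := ℂ) y x
  rw [h1] at h3
  have h4 : RCLike.re ((∑ i ∈ s, ‖inner ℂ (f i) x‖ ^ 2 : ℝ) : ℂ) =
    ∑ i ∈ s, ‖inner ℂ (f i) x‖ ^ 2 := Complex.ofReal_re _
  rw [h4] at h3
  nlinarith [sq_nonneg ‖y - x‖]

theorem IsSuborthonormal.sum_norm_mul_norm_le {f g : ℕ → H} (hf : IsSuborthonormal f)
    (hg : IsSuborthonormal g) (s : Finset ℕ) {x y : H} (hx : ‖x‖ ≤ 1) (hy : ‖y‖ ≤ 1) :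
    ∑ i ∈ s, ‖inner ℂ (f i) x‖ * ‖inner ℂ (g i) y‖ ≤ 1 := by
  have h1 := (hf.bessel s x).trans (pow_le_one₀ (norm_nonneg _) hx)
  have h2 := (hg.bessel s y).trans (pow_le_one₀ (norm_nonneg _) hy)
  have h3 : ∑ i ∈ s, ‖inner ℂ (f i) x‖ * ‖inner ℂ (g i) y‖ ≤
      ∑ i ∈ s, (‖inner ℂ (f i) x‖ ^ 2 + ‖inner ℂ (g i) y‖ ^ 2) / 2 :=
    Finset.sum_le_sum fun i _ => by
      nlinarith [sq_nonneg (‖inner ℂ (f i) x‖ - ‖inner ℂ (g i) y‖)]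
  rw [← Finset.sum_div, Finset.sum_add_distrib] at h3
  linarith

theorem inner_eq_zero_of_mem_orthogonal_span {ι : Type*} {v : ι → H} {x : H}
    (hx : x ∈ (Submodule.span ℂ (Set.range v))ᗮ) (i : ι) : inner ℂ (v i) x = 0 :=
  hx _ (Submodule.subset_span ⟨i, rfl⟩)

variable [CompleteSpace H]

/-! ### Singular values: elementary properties -/

theorem singularValue_nonneg (T : H →L[ℂ] H) (n : ℕ) : 0 ≤ singularValue T n :=
  Real.sInf_nonneg fun _ ht => ht.1

theorem sigma_nonneg (n : ℕ) (T : H →L[ℂ] H) : 0 ≤ sigma n T :=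
  Finset.sum_nonneg fun _ _ => singularValue_nonneg T _

theorem sigma_succ (n : ℕ) (T : H →L[ℂ] H) : sigma (n + 1) T = sigma n T + singularValue T n :=
  Finset.sum_range_succ _ _

section System

variable {T : H →L[ℂ] H} {s : ℕ → ℝ} {e : ℕ → H}

theorem IsSingularSystem.norm_le_one (h : IsSingularSystem T s e) (j : ℕ) : ‖e j‖ ≤ 1 := by
  by_cases h0 : s j = 0
  · simp [h.eq_zero j h0]
  · rw [h.norm_eq_one j h0]

theorem IsSingularSystem.isSuborthonormal (h : IsSingularSystem T s e) : IsSuborthonormal e :=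
  ⟨h.orthogonal, h.norm_le_one⟩

theorem IsSingularSystem.inner_apply (h : IsSingularSystem T s e) (x : H) (j : ℕ) :
    inner ℂ (T (e j)) (T x) = (s j : ℂ) ^ 2 * inner ℂ (e j) x := by
  have hs : IsSelfAdjoint (CFC.abs T) := (CFC.abs_nonneg T).isSelfAdjoint
  rw [← inner_abs_apply, h.apply_eq, inner_smul_left, ← ContinuousLinearMap.adjoint_inner_left,
    hs.adjoint_eq, h.apply_eq, inner_smul_left, Complex.conj_ofReal]
  ring

/-- The left singular vectors are `s j⁻¹ T (e j)`. The convention `0⁻¹ = 0` makes them vanish with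
`s j`, and `⟨T (e j), T x⟩ = s j² ⟨e j, x⟩` carries orthogonality over. -/
theorem IsSingularSystem.exists_left (h : IsSingularSystem T s e) :
    ∃ g : ℕ → H, IsSuborthonormal g ∧ (∀ j, ‖g j‖ ≤ ‖e j‖) ∧ (∀ j, T (e j) = (s j : ℂ) • g j) ∧
      (∀ x j, inner ℂ (e j) x = 0 → inner ℂ (g j) (T x) = 0) ∧
      ∀ j, inner ℂ (g j) (T (e j)) = s j := by
  have hn : ∀ j, ‖T (e j)‖ = s j * ‖e j‖ := fun j => by
    rw [← norm_abs_apply, h.apply_eq, norm_smul, Complex.norm_real, Real.norm_of_nonneg (h.nonneg j)]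
  have hle : ∀ j, ‖((s j : ℂ)⁻¹ • T (e j))‖ ≤ ‖e j‖ := fun j => by
    rw [norm_smul, norm_inv, Complex.norm_real, Real.norm_of_nonneg (h.nonneg j), hn, ← mul_assoc]
    exact mul_le_of_le_one_left (norm_nonneg _) inv_mul_le_one
  have horth : ∀ x j, inner ℂ (e j) x = 0 → inner ℂ ((s j : ℂ)⁻¹ • T (e j)) (T x) = 0 :=
    fun x j hx => by rw [inner_smul_left, h.inner_apply, hx, mul_zero, mul_zero]
  refine ⟨fun j => (s j : ℂ)⁻¹ • T (e j), ⟨fun i j hij => ?_, fun j => (hle j).trans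
    (h.norm_le_one j)⟩, hle, fun j => ?_, horth, fun j => ?_⟩
  · rw [inner_smul_right, horth _ _ (h.orthogonal i j hij), mul_zero]
  · by_cases h0 : s j = 0
    · simp [h.eq_zero j h0]
    · rw [smul_inv_smul₀ (by exact_mod_cast h0)]
  · by_cases h0 : s j = 0
    · simp [h0]
    · have h0' : (s j : ℂ) ≠ 0 := by exact_mod_cast h0
      rw [inner_smul_left, h.inner_apply, inner_self_eq_norm_sq_to_K, h.norm_eq_one j h0]
      simp
      field_simp

end System

/-! ### The minimax bound -/

/-- One half of the minimax principle: if `‖T x‖ ≤ c ‖x‖` on a subspace of codimension at most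
`n`, then the singular value with index `n` is at most `c`. -/
theorem singularValue_le_of_forall_mem_orthogonal {T : H →L[ℂ] H} (hT : IsCompactOperator T) {n : ℕ}
    {c : ℝ} (hc : 0 ≤ c) (K : Submodule ℂ H) [FiniteDimensional ℂ K]
    (hK : Module.finrank ℂ K ≤ n) (h : ∀ x ∈ Kᗮ, ‖T x‖ ≤ c * ‖x‖) : singularValue T n ≤ c := by
  obtain ⟨e, he⟩ := exists_isSingularSystem hT
  by_contra! hlt
  have hon := he.orthonormal (hc.trans_lt hlt).ne'
  let L : (Fin (n + 1) → ℂ) →ₗ[ℂ] H := Fintype.linearCombination ℂ fun i : Fin (n + 1) => e i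
  -- The `n + 1` vectors `e 0, …, e n` outnumber the dimension of `K`, so a non-trivial combination
  -- is orthogonal to `K`. On their span `T` expands norms by at least its singular value `n`.
  have hker := LinearMap.ker_ne_bot_of_finrank_lt
    (f := (K.orthogonalProjectionOnto : H →ₗ[ℂ] K) ∘ₗ L) (by simpa using Nat.lt_succ_of_le hK)
  obtain ⟨a, ha, ha0⟩ := Submodule.exists_mem_ne_zero_of_ne_bot hker
  have hx : L a ∈ Kᗮ := by
    rw [← Submodule.orthogonalProjectionOnto_eq_zero_iff]
    exact ha
  have hLa : L a = ∑ i, a i • e i := Fintype.linearCombination_apply _ _ _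
  have horth : ∀ i j : Fin (n + 1), i ≠ j → inner ℂ (e i) (e j) = 0 := fun i j hij =>
    he.orthogonal i j fun hh => hij (Fin.ext hh)
  have h1 : ‖L a‖ ^ 2 = ∑ i, ‖a i‖ ^ 2 := by
    rw [hLa, norm_sq_sum_of_orthogonal]
    · refine Finset.sum_congr rfl fun i _ => ?_
      rw [norm_smul, hon.1 i, mul_one]
    · intro i j hij
      rw [inner_smul_left, inner_smul_right, horth i j hij, mul_zero, mul_zero]
  have h2 : singularValue T n ^ 2 * ‖L a‖ ^ 2 ≤ ‖T (L a)‖ ^ 2 := by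
    rw [h1, ← norm_abs_apply, hLa, map_sum, norm_sq_sum_of_orthogonal, Finset.mul_sum]
    · refine Finset.sum_le_sum fun i _ => ?_
      rw [map_smul, he.apply_eq, norm_smul, norm_smul, hon.1 i, mul_one, Complex.norm_real,
        Real.norm_of_nonneg (he.nonneg _), mul_pow, mul_comm]
      exact mul_le_mul_of_nonneg_left (pow_le_pow_left₀ (he.nonneg _)
        (he.antitone (Nat.lt_succ_iff.1 i.2)) 2) (sq_nonneg _)
    · intro i j hij
      rw [map_smul, map_smul, he.apply_eq, he.apply_eq, inner_smul_left, inner_smul_right,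
        inner_smul_left, inner_smul_right, horth i j hij]
      simp
  have h3 : 0 < ‖L a‖ ^ 2 := by
    rw [h1]
    obtain ⟨i, hi⟩ := Function.ne_iff.1 ha0
    exact Finset.sum_pos' (fun _ _ => sq_nonneg _)
      ⟨i, Finset.mem_univ _, by have := norm_pos_iff.2 hi; positivity⟩
  have h4 : ‖T (L a)‖ ^ 2 ≤ c ^ 2 * ‖L a‖ ^ 2 := by
    rw [← mul_pow]
    exact pow_le_pow_left₀ (norm_nonneg _) (h _ hx) 2
  have h5 := le_of_mul_le_mul_right (h2.trans h4) h3
  exact absurd (pow_lt_pow_left₀ hlt hc two_ne_zero) (not_lt.2 h5)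

theorem singularValue_le_mul {S T : H →L[ℂ] H} (hT : IsCompactOperator T) {c : ℝ} (hc : 0 ≤ c)
    (h : ∀ x, ‖S x‖ ≤ c * ‖T x‖) (n : ℕ) : singularValue S n ≤ c * singularValue T n := by
  obtain ⟨e, he⟩ := exists_isSingularSystem hT
  have := FiniteDimensional.span_of_finite ℂ (Set.finite_range fun i : Fin n => e i)
  refine singularValue_le_of_forall_mem_orthogonal (isCompactOperator_of_norm_le hT hc h)
    (mul_nonneg hc (he.nonneg n)) (Submodule.span ℂ (Set.range fun i : Fin n => e i))
    ((finrank_range_le_card _).trans (Fintype.card_fin n).le) fun x hx => ?_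
  refine (h x).trans ?_
  rw [mul_assoc]
  exact mul_le_mul_of_nonneg_left (he.norm_le n x fun j hj =>
    inner_eq_zero_of_mem_orthogonal_span hx ⟨j, hj⟩) hc

theorem sigma_le_mul {S T : H →L[ℂ] H} (hT : IsCompactOperator T) {c : ℝ} (hc : 0 ≤ c)
    (h : ∀ x, ‖S x‖ ≤ c * ‖T x‖) (n : ℕ) : sigma n S ≤ c * sigma n T := by
  rw [sigma, sigma, Finset.mul_sum]
  exact Finset.sum_le_sum fun j _ => singularValue_le_mul hT hc h j

/-! ### Ky Fan's variational principle -/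

/-- Lowering the first `N` singular values by `s N` leaves an operator that acts with size at most
`s N` on the leading vectors and on their complement alike. This finite-rank splitting replaces the
infinite singular value expansion. -/
theorem IsSingularSystem.norm_sub_apply_le {T : H →L[ℂ] H} {s : ℕ → ℝ} {e : ℕ → H}
    (h : IsSingularSystem T s e) {g : ℕ → H} (hg : IsSuborthonormal g) (hge : ∀ j, ‖g j‖ ≤ ‖e j‖)
    (hgT : ∀ j, T (e j) = (s j : ℂ) • g j)
    (hgx : ∀ x j, inner ℂ (e j) x = 0 → inner ℂ (g j) (T x) = 0) (N : ℕ) (x : H) :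
    ‖T x - ∑ j ∈ Finset.range N, ((s j - s N : ℝ) * inner ℂ (e j) x : ℂ) • g j‖ ≤ s N * ‖x‖ := by
  set q := x - ∑ i ∈ Finset.range N, inner ℂ (e i) x • e i with hq
  have hqe : ∀ j < N, inner ℂ (e j) q = 0 := fun j hj => h.inner_sub_sum hj x
  have hx : x = q + ∑ i ∈ Finset.range N, inner ℂ (e i) x • e i := by rw [hq, sub_add_cancel]
  have h1 : T x - ∑ j ∈ Finset.range N, ((s j - s N : ℝ) * inner ℂ (e j) x : ℂ) • g j =
      T q + ∑ j ∈ Finset.range N, ((s N : ℂ) * inner ℂ (e j) x) • g j := by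
    conv_lhs => rw [hx, map_add, map_sum]
    rw [← hx, add_sub_assoc, ← Finset.sum_sub_distrib]
    congr 1
    refine Finset.sum_congr rfl fun j _ => ?_
    rw [map_smul, hgT, smul_smul, ← sub_smul]
    congr 1
    push_cast
    ring
  have h2 : inner ℂ (T q) (∑ j ∈ Finset.range N, ((s N : ℂ) * inner ℂ (e j) x) • g j) = 0 := by
    rw [inner_sum]
    refine Finset.sum_eq_zero fun j hj => ?_
    rw [inner_smul_right, inner_eq_zero_symm.1 (hgx _ _ (hqe j (Finset.mem_range.1 hj))), mul_zero]
  have h3 : inner ℂ q (∑ i ∈ Finset.range N, inner ℂ (e i) x • e i) = 0 := by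
    rw [inner_sum]
    refine Finset.sum_eq_zero fun j hj => ?_
    rw [inner_smul_right, inner_eq_zero_symm.1 (hqe j (Finset.mem_range.1 hj)), mul_zero]
  have h4 : ‖x‖ ^ 2 = ‖q‖ ^ 2 + ∑ i ∈ Finset.range N, ‖inner ℂ (e i) x • e i‖ ^ 2 := by
    conv_lhs => rw [hx]
    rw [norm_add_sq (𝕜 := ℂ), h3, norm_sq_sum_of_orthogonal]
    · simp
    · intro i j hij
      rw [inner_smul_left, inner_smul_right, h.orthogonal i j hij, mul_zero, mul_zero]
  rw [h1]
  refine le_of_pow_le_pow_left₀ two_ne_zero (mul_nonneg (h.nonneg N) (norm_nonneg x)) ?_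
  rw [norm_add_sq (𝕜 := ℂ), h2, norm_sq_sum_of_orthogonal, mul_pow, h4, mul_add, Finset.mul_sum]
  · rw [map_zero, mul_zero, add_zero]
    refine add_le_add ?_ (Finset.sum_le_sum fun j _ => ?_)
    · rw [← mul_pow]
      exact pow_le_pow_left₀ (norm_nonneg _) (h.norm_le N q hqe) 2
    · rw [← mul_pow]
      refine pow_le_pow_left₀ (norm_nonneg _) ?_ 2
      rw [norm_smul, norm_smul, norm_mul, Complex.norm_real, Real.norm_of_nonneg (h.nonneg N),
        mul_assoc]
      exact mul_le_mul_of_nonneg_left (mul_le_mul_of_nonneg_left (hge j) (norm_nonneg _))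
        (h.nonneg N)
  · intro i j hij
    rw [inner_smul_left, inner_smul_right, hg.orthogonal i j hij, mul_zero, mul_zero]

/-- The remainder of norm at most `s N` contributes at most `N * s N`. Each rank-one term
contributes at most `s j - s N` by Bessel's inequality in both families. The total is `sigma N T`.
-/
theorem sum_norm_inner_le_sigma {T : H →L[ℂ] H} (hT : IsCompactOperator T) {f g : ℕ → H}
    (hf : IsSuborthonormal f) (hg : IsSuborthonormal g) (N : ℕ) :
    ∑ i ∈ Finset.range N, ‖inner ℂ (g i) (T (f i))‖ ≤ sigma N T := by
  obtain ⟨e, he⟩ := exists_isSingularSystem hT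
  obtain ⟨k, hk, hke, hkT, hkx, -⟩ := he.exists_left
  set s := singularValue T with hs
  have h1 : ∀ i, ‖inner ℂ (g i) (T (f i))‖ ≤ s N +
      ∑ j ∈ Finset.range N, (s j - s N) * (‖inner ℂ (f i) (e j)‖ * ‖inner ℂ (g i) (k j)‖) := by
    intro i
    have h2 := he.norm_sub_apply_le hk hke hkT hkx N (f i)
    set R := ∑ j ∈ Finset.range N, ((s j - s N : ℝ) * inner ℂ (e j) (f i) : ℂ) • k j with hR
    have h3 : inner ℂ (g i) (T (f i)) = inner ℂ (g i) (T (f i) - R) + inner ℂ (g i) R := by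
      rw [inner_sub_right, sub_add_cancel]
    rw [h3]
    refine (norm_add_le _ _).trans (add_le_add ?_ ?_)
    · refine (norm_inner_le_norm _ _).trans ?_
      have h5 : s N * ‖f i‖ ≤ s N := mul_le_of_le_one_right (he.nonneg N) (hf.norm_le_one i)
      have h6 := hg.norm_le_one i
      nlinarith [norm_nonneg (g i), norm_nonneg (T (f i) - R)]
    · rw [hR, inner_sum]
      refine (norm_sum_le _ _).trans (Finset.sum_le_sum fun j hj => le_of_eq ?_)
      have h7 : 0 ≤ s j - s N := sub_nonneg.2 (he.antitone (Finset.mem_range.1 hj).le)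
      rw [inner_smul_right, norm_mul, norm_mul, Complex.norm_real, Real.norm_of_nonneg h7, mul_assoc,
        norm_inner_symm (e j)]
  refine (Finset.sum_le_sum fun i _ => h1 i).trans ?_
  rw [Finset.sum_add_distrib, Finset.sum_comm]
  have h8 : ∀ j ∈ Finset.range N, ∑ i ∈ Finset.range N,
      (s j - s N) * (‖inner ℂ (f i) (e j)‖ * ‖inner ℂ (g i) (k j)‖) ≤ s j - s N := by
    intro j hj
    have h7 : 0 ≤ s j - s N := sub_nonneg.2 (he.antitone (Finset.mem_range.1 hj).le)
    rw [← Finset.mul_sum]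
    exact mul_le_of_le_one_right h7
      (hf.sum_norm_mul_norm_le hg _ (he.norm_le_one j) (hk.norm_le_one j))
  refine (add_le_add_right (Finset.sum_le_sum h8) _).trans (le_of_eq ?_)
  rw [← Finset.sum_add_distrib, sigma]
  exact Finset.sum_congr rfl fun j _ => by ring

theorem exists_inner_eq_singularValue {T : H →L[ℂ] H} (hT : IsCompactOperator T) :
    ∃ f g : ℕ → H, IsSuborthonormal f ∧ IsSuborthonormal g ∧
      ∀ i, inner ℂ (g i) (T (f i)) = singularValue T i := by
  obtain ⟨e, he⟩ := exists_isSingularSystem hT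
  obtain ⟨k, hk, -, -, -, h⟩ := he.exists_left
  exact ⟨e, k, he.isSuborthonormal, hk, h⟩

theorem sigma_le_sum_norm {T : H →L[ℂ] H} {f g : ℕ → H}
    (h : ∀ i, inner ℂ (g i) (T (f i)) = singularValue T i) (n : ℕ) :
    sigma n T ≤ ∑ i ∈ Finset.range n, ‖inner ℂ (g i) (T (f i))‖ :=
  Finset.sum_le_sum fun i _ => by
    rw [h, Complex.norm_real]
    exact le_abs_self _

theorem sigma_add_le {X Y : H →L[ℂ] H} (hX : IsCompactOperator X) (hY : IsCompactOperator Y)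
    (n : ℕ) : sigma n (X + Y) ≤ sigma n X + sigma n Y := by
  obtain ⟨f, g, hf, hg, h⟩ := exists_inner_eq_singularValue (T := X + Y) (hX.add hY)
  refine (sigma_le_sum_norm h n).trans ?_
  refine le_trans ?_ (add_le_add (sum_norm_inner_le_sigma hX hf hg n)
    (sum_norm_inner_le_sigma hY hf hg n))
  rw [← Finset.sum_add_distrib]
  refine Finset.sum_le_sum fun i _ => ?_
  rw [add_apply, inner_add_right]
  exact norm_add_le _ _

theorem sigma_star_le {T : H →L[ℂ] H} (hT : IsCompactOperator T) (n : ℕ) :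
    sigma n (star T) ≤ sigma n T := by
  obtain ⟨f, g, hf, hg, h⟩ := exists_inner_eq_singularValue (isCompactOperator_adjoint hT)
  refine (sigma_le_sum_norm h n).trans (le_trans (le_of_eq ?_) (sum_norm_inner_le_sigma hT hg hf n))
  refine Finset.sum_congr rfl fun i _ => ?_
  rw [ContinuousLinearMap.star_eq_adjoint, ContinuousLinearMap.adjoint_inner_right, norm_inner_symm]

theorem sigma_mul_left_le {Z : H →L[ℂ] H} (hZ : IsCompactOperator Z) (B : H →L[ℂ] H) (n : ℕ) :
    sigma n (B * Z) ≤ ‖B‖ * sigma n Z :=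
  sigma_le_mul hZ (norm_nonneg B) (fun x => B.le_opNorm (Z x)) n

theorem sigma_mul_right_le {Z : H →L[ℂ] H} (hZ : IsCompactOperator Z) (B : H →L[ℂ] H) (n : ℕ) :
    sigma n (Z * B) ≤ ‖B‖ * sigma n Z := by
  have hs := isCompactOperator_adjoint hZ
  have h1 : Z * B = star (star B * star Z) := by rw [star_mul, star_star, star_star]
  rw [h1]
  refine (sigma_star_le (hs.clm_comp (star B)) n).trans ((sigma_mul_left_le hs _ n).trans ?_)
  rw [norm_star]
  exact mul_le_mul_of_nonneg_left (sigma_star_le hZ n) (norm_nonneg B)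

theorem sigma_smul_le {Z : H →L[ℂ] H} (hZ : IsCompactOperator Z) (c : ℂ) (n : ℕ) :
    sigma n (c • Z) ≤ ‖c‖ * sigma n Z :=
  sigma_le_mul hZ (norm_nonneg c) (fun x => (norm_smul c (Z x)).le) n

theorem sigma_smul {Z : H →L[ℂ] H} (hZ : IsCompactOperator Z) (c : ℂ) (n : ℕ) :
    sigma n (c • Z) = ‖c‖ * sigma n Z := by
  refine le_antisymm (sigma_smul_le hZ c n) ?_
  by_cases hc : c = 0
  · simpa [hc] using sigma_nonneg n (0 : H →L[ℂ] H)
  · have h1 := sigma_smul_le (Z := c • Z) (hZ.smul c) c⁻¹ n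
    rw [inv_smul_smul₀ hc, norm_inv] at h1
    rwa [← le_inv_mul_iff₀ (norm_pos_iff.2 hc)]

/-- The second Ky Fan inequality. -/
theorem sigma_add_sigma_le {X Y : H →L[ℂ] H} (hX : IsCompactOperator X) (hY : IsCompactOperator Y)
    (hX0 : 0 ≤ X) (hY0 : 0 ≤ Y) (n : ℕ) : sigma n X + sigma n Y ≤ sigma (2 * n) (X + Y) := by
  -- For `K` spanned by the first `n` eigenvectors of `Z`, the trace of the compression of `Z` to
  -- any `V` containing `K` is at least `sigma n Z`.
  have key : ∀ {Z : H →L[ℂ] H}, 0 ≤ Z → IsCompactOperator Z → ∃ K : Submodule ℂ H,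
      FiniteDimensional ℂ K ∧ Module.finrank ℂ K ≤ n ∧ ∀ (V : Submodule ℂ H)
        (b : OrthonormalBasis (Fin (Module.finrank ℂ V)) ℂ V), K ≤ V →
        sigma n Z ≤ ∑ i, RCLike.re (inner ℂ (b i : H) (Z (b i))) := by
    intro Z hZ0 hZ
    obtain ⟨e, he⟩ := exists_isSingularSystem hZ
    have hpos := (ContinuousLinearMap.nonneg_iff_isPositive Z).1 hZ0
    have hsa : ∀ x y, inner ℂ (Z x) y = inner ℂ x (Z y) := fun x y => hpos.isSymmetric x y
    have heig : ∀ j, Z (e j) = (singularValue Z j : ℂ) • e j := fun j => by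
      have := he.apply_eq j
      rwa [CFC.abs_of_nonneg Z hZ0] at this
    refine ⟨Submodule.span ℂ (Set.range fun i : Fin n => e i),
      FiniteDimensional.span_of_finite ℂ (Set.finite_range _),
      (finrank_range_le_card _).trans (Fintype.card_fin n).le, fun V b hV => ?_⟩
    -- The quadratic form splits along the leading eigenvectors and the remainder `q`; positivity
    -- allows `⟨q, Z q⟩` to be dropped.
    have h1 : ∀ x : H, ∑ j ∈ Finset.range n, singularValue Z j * ‖inner ℂ (e j) x‖ ^ 2 ≤
        RCLike.re (inner ℂ x (Z x)) := by
      intro x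
      set q := x - ∑ i ∈ Finset.range n, inner ℂ (e i) x • e i with hq
      have hqe : ∀ j < n, inner ℂ (e j) q = 0 := fun j hj => he.inner_sub_sum hj x
      have hx : x = q + ∑ i ∈ Finset.range n, inner ℂ (e i) x • e i := by rw [hq, sub_add_cancel]
      have h2 : inner ℂ q (Z x) = inner ℂ q (Z q) := by
        conv_lhs => rw [hx]
        rw [map_add, inner_add_right, map_sum, inner_sum, Finset.sum_eq_zero, add_zero]
        intro j hj
        rw [map_smul, heig, inner_smul_right, inner_smul_right,
          inner_eq_zero_symm.1 (hqe j (Finset.mem_range.1 hj)), mul_zero, mul_zero]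
      have h3 : inner ℂ (x - q) (Z x) =
          ((∑ j ∈ Finset.range n, singularValue Z j * ‖inner ℂ (e j) x‖ ^ 2 : ℝ) : ℂ) := by
        rw [hq, sub_sub_cancel, sum_inner]
        push_cast
        refine Finset.sum_congr rfl fun j _ => ?_
        rw [inner_smul_left, ← hsa, heig, inner_smul_left, Complex.conj_ofReal, mul_left_comm,
          RCLike.conj_mul]
        rfl
      have h4 : inner ℂ x (Z x) = inner ℂ q (Z q) + inner ℂ (x - q) (Z x) := by
        rw [← h2, ← inner_add_left, add_sub_cancel]
      have h5 : 0 ≤ RCLike.re (inner ℂ q (Z q)) := hpos.re_inner_nonneg_right q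
      rw [h4, map_add, h3]
      exact le_add_of_nonneg_of_le h5 (le_of_eq (Complex.ofReal_re _).symm)
    refine le_trans ?_ (Finset.sum_le_sum fun i _ => h1 (b i))
    rw [Finset.sum_comm, sigma]
    refine Finset.sum_le_sum fun j hj => ?_
    rw [← Finset.mul_sum]
    by_cases h0 : singularValue Z j = 0
    · simp [h0]
    · have hjV : e j ∈ V := hV (Submodule.subset_span ⟨⟨j, Finset.mem_range.1 hj⟩, rfl⟩)
      -- Parseval in `V` for the unit vector `e j`, which lies in `K ≤ V`.
      have h6 : ∑ i, ‖inner ℂ (e j) (b i : H)‖ ^ 2 = 1 := by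
        have := b.sum_sq_norm_inner_left (⟨e j, hjV⟩ : V)
        simp only [Submodule.coe_inner, Submodule.coe_norm] at this
        rw [he.norm_eq_one j h0] at this
        simpa using this
      rw [h6, mul_one]
  obtain ⟨K, hKf, hKn, hK⟩ := key hX0 hX
  obtain ⟨L, hLf, hLn, hL⟩ := key hY0 hY
  let V := K ⊔ L
  have hVn : Module.finrank ℂ V ≤ 2 * n := by
    have := Submodule.finrank_add_le_finrank_add_finrank K L
    exact this.trans (by omega)
  let b := stdOrthonormalBasis ℂ V
  -- The basis of `V` is continued by zeros, so that Ky Fan's bound applies with `2 * n` vectors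
  -- even if `V` is smaller.
  let f : ℕ → H := fun i => if hi : i < Module.finrank ℂ V then (b ⟨i, hi⟩ : H) else 0
  have hf : IsSuborthonormal f := by
    refine ⟨fun i j hij => ?_, fun i => ?_⟩
    · by_cases hi : i < Module.finrank ℂ V
      · by_cases hj : j < Module.finrank ℂ V
        · simp only [f, hi, hj, dif_pos]
          have := b.orthonormal.2 (i := ⟨i, hi⟩) (j := ⟨j, hj⟩) (by simpa using hij)
          simpa using this
        · simp [f, hj]
      · simp [f, hi]
    · by_cases hi : i < Module.finrank ℂ V
      · simp only [f, hi, dif_pos]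
        have := b.orthonormal.1 ⟨i, hi⟩
        exact this.le
      · simp [f, hi]
  have h1 := sum_norm_inner_le_sigma (T := X + Y) (hX.add hY) hf hf (2 * n)
  refine le_trans ?_ h1
  have h2 := Finset.sum_le_sum_of_subset_of_nonneg (Finset.range_mono hVn)
    (f := fun i => ‖inner ℂ (f i) ((X + Y) (f i))‖) fun _ _ _ => norm_nonneg _
  refine le_trans ?_ h2
  rw [Finset.sum_range]
  refine (add_le_add (hK V b le_sup_left) (hL V b le_sup_right)).trans ?_
  rw [← Finset.sum_add_distrib]
  refine Finset.sum_le_sum fun i _ => ?_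
  simp only [f, i.2, dif_pos, ← map_add, ← inner_add_right]
  exact RCLike.re_le_norm _

end

section

/-! ### Dilation-invariant states -/

theorem exists_isDilationInvariantState : ∃ ω : StrongDual ℝ LInfty, IsDilationInvariantState ω := by
  -- With indices from zero the dilation reads entry `n / 2`, hence it shifts the subsequence at
  -- powers of two by one step. Cesàro means are asymptotically blind to that shift.
  let avg : LInfty → ℕ → ℝ := fun η N => (N : ℝ)⁻¹ * ∑ k ∈ Finset.range N, η (2 ^ k)
  have hη : ∀ (η : LInfty) n, |η n| ≤ ‖η‖ := fun η n => lp.norm_apply_le_norm ENNReal.top_ne_zero η n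
  have hbd : ∀ η N, |avg η N| ≤ ‖η‖ := by
    intro η N
    have h1 : |∑ k ∈ Finset.range N, η (2 ^ k)| ≤ N * ‖η‖ := by
      refine (Finset.abs_sum_le_sum_abs _ _).trans ((Finset.sum_le_sum fun k _ => hη η (2 ^ k)).trans ?_)
      simp
    rw [abs_mul, abs_inv, Nat.abs_cast]
    rcases Nat.eq_zero_or_pos N with rfl | hN
    · simp
    · rwa [inv_mul_le_iff₀ (by exact_mod_cast hN)]
  have hlim : ∀ η, ∃ l, Tendsto (avg η) (hyperfilter ℕ : Filter ℕ) (𝓝 l) := by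
    intro η
    obtain ⟨l, -, hl⟩ := (isCompact_Icc (a := -‖η‖) (b := ‖η‖)).ultrafilter_le_nhds
      ((hyperfilter ℕ).map (avg η)) (by
        rw [Ultrafilter.coe_map, le_principal_iff, Filter.mem_map]
        exact Filter.univ_mem' fun N => abs_le.1 (hbd η N))
    exact ⟨l, hl⟩
  choose L hL using hlim
  have huniq : ∀ η l, Tendsto (avg η) (hyperfilter ℕ : Filter ℕ) (𝓝 l) → L η = l :=
    fun η l h => tendsto_nhds_unique (hL η) h
  have hconv : ∀ (η : LInfty) l, Tendsto (fun n => η n) atTop (𝓝 l) → L η = l := by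
    intro η l h
    have h1 : Tendsto (fun k : ℕ => η (2 ^ k)) atTop (𝓝 l) :=
      h.comp (tendsto_pow_atTop_atTop_of_one_lt one_lt_two)
    exact huniq η l (h1.cesaro.mono_left Nat.hyperfilter_le_atTop)
  let Λ : LInfty →ₗ[ℝ] ℝ :=
    { toFun := L
      map_add' := fun η ζ => huniq _ _ (((hL η).add (hL ζ)).congr fun N => by
        simp only [avg, lp.coeFn_add, Pi.add_apply, Finset.sum_add_distrib, mul_add])
      map_smul' := fun c η => huniq _ _ (((hL η).const_mul c).congr fun N => by
        simp only [avg, lp.coeFn_smul, Pi.smul_apply, smul_eq_mul, ← Finset.mul_sum]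
        ring) }
  refine ⟨Λ.mkContinuous 1 fun η => ?_, ?_, ?_, ?_, ?_⟩
  · rw [one_mul]
    exact le_of_tendsto' (hL η).abs (hbd η)
  · intro η h
    exact ge_of_tendsto' (hL η) fun N =>
      mul_nonneg (by positivity) (Finset.sum_nonneg fun k _ => h _)
  · intro η h
    exact hconv η 1 (tendsto_const_nhds.congr fun n => (h n).symm)
  · intro η a _ h
    exact hconv η a h
  · intro η
    refine huniq _ _ ?_
    have h1 : Tendsto (fun N : ℕ => (N : ℝ)⁻¹ * (2 * ‖η‖)) atTop (𝓝 0) := by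
      simpa using (tendsto_inv_atTop_nhds_zero_nat (𝕜 := ℝ)).mul_const (2 * ‖η‖)
    have h2 : ∀ N, |avg (dilation η) N - avg η N| ≤ (N : ℝ)⁻¹ * (2 * ‖η‖) := by
      intro N
      rw [← mul_sub, abs_mul, abs_inv, Nat.abs_cast]
      refine mul_le_mul_of_nonneg_left ?_ (by positivity)
      rcases N with _ | N
      · simp
      · have h3 : ∀ n, dilation η n = η (n / 2) := fun n => rfl
        have h4 : ∀ k, 2 ^ (k + 1) / 2 = 2 ^ k := fun k => by
          rw [pow_succ, Nat.mul_div_cancel _ two_pos]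
        rw [Finset.sum_range_succ', Finset.sum_range_succ]
        simp only [h3, h4]
        rw [add_sub_add_left_eq_sub]
        exact (abs_sub _ _).trans ((add_le_add (hη η _) (hη η _)).trans (two_mul _).symm.le)
    have h3 := squeeze_zero_norm (f := fun N => avg (dilation η) N - avg η N) h2 h1
    have h4 := (h3.mono_left Nat.hyperfilter_le_atTop).add (hL η)
    rw [zero_add] at h4
    exact h4.congr fun N => sub_add_cancel _ _

section State

variable {ω : StrongDual ℝ LInfty}

theorem IsDilationInvariantState.mono (hω : IsDilationInvariantState ω) {η ζ : LInfty}
    (h : ∀ n, η n ≤ ζ n) : ω η ≤ ω ζ := by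
  have := hω.nonneg (ζ - η) fun n => by
    rw [lp.coeFn_sub, Pi.sub_apply]
    exact sub_nonneg.2 (h n)
  rw [map_sub] at this
  linarith

theorem IsDilationInvariantState.le_of_le_const (hω : IsDilationInvariantState ω) {η : LInfty}
    {c : ℝ} (h : ∀ n, η n ≤ c) : ω η ≤ c := by
  have h1 := hω.normalised 1 fun n => rfl
  have h2 : ω η ≤ ω (c • 1) := hω.mono fun n => by
    have : (c • (1 : LInfty)) n = c := by
      rw [lp.coeFn_smul, Pi.smul_apply]
      exact mul_one c
    rw [this]
    exact h n
  rwa [map_smul, h1, smul_eq_mul, mul_one] at h2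

theorem memℓp_infty_of_tendsto {z : ℕ → ℝ} {a : ℝ} (hz : Tendsto z atTop (𝓝 a)) : Memℓp z ∞ :=
  memℓp_infty hz.norm.bddAbove_range

/-- States ignore null errors. The error is taken non-negative because `eq_lim` covers only
non-negative sequences. -/
theorem IsDilationInvariantState.le_of_le_add (hω : IsDilationInvariantState ω) {η ζ : LInfty}
    {z : ℕ → ℝ} (hz0 : ∀ n, 0 ≤ z n) (hz : Tendsto z atTop (𝓝 0)) (h : ∀ n, η n ≤ ζ n + z n) :
    ω η ≤ ω ζ := by
  let z' : LInfty := ⟨z, memℓp_infty_of_tendsto hz⟩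
  have h1 : ω z' = 0 := hω.eq_lim z' 0 hz0 hz
  have h2 : ω η ≤ ω (ζ + z') := hω.mono fun n => by
    rw [lp.coeFn_add, Pi.add_apply]
    exact h n
  rwa [map_add, h1, add_zero] at h2

end State

/-! ### Logarithmic weights and finite-rank operators. -/

theorem log_succ_nonneg (n : ℕ) : 0 ≤ Real.log ((n + 1 : ℕ) : ℝ) := Real.log_natCast_nonneg _

theorem one_add_log_pos (n : ℕ) : 0 < 1 + Real.log ((n + 1 : ℕ) : ℝ) := by
  linarith [log_succ_nonneg n]

theorem tendsto_const_div_one_add_log (c : ℝ) :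
    Tendsto (fun n : ℕ => c / (1 + Real.log ((n + 1 : ℕ) : ℝ))) atTop (𝓝 0) := by
  refine Tendsto.div_atTop tendsto_const_nhds (tendsto_atTop_add_const_left _ _ ?_)
  exact Real.tendsto_log_atTop.comp
    (tendsto_natCast_atTop_atTop.comp (tendsto_add_atTop_nat 1))

variable {H : Type*} [NormedAddCommGroup H] [InnerProductSpace ℂ H]

theorem IsFiniteRank.isCompactOperator {F : H →L[ℂ] H} (hF : IsFiniteRank F) :
    IsCompactOperator F := by
  have : FiniteDimensional ℂ (LinearMap.range (F : H →ₗ[ℂ] H)) := hF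
  have : ProperSpace (LinearMap.range (F : H →ₗ[ℂ] H)) := FiniteDimensional.proper ℂ _
  exact (isCompactOperator_of_locallyCompactSpace_rng
    (LinearMap.range (F : H →ₗ[ℂ] H)).subtypeL).comp_clm
    (F.codRestrict (LinearMap.range (F : H →ₗ[ℂ] H)) fun x => ⟨x, rfl⟩)

variable [CompleteSpace H]

/-! ### The Dixmier ideal -/

theorem MemDixmierIdeal.of_sigma_le {S T : H →L[ℂ] H} (hT : MemDixmierIdeal T)
    (hS : IsCompactOperator S) (c : ℝ) (h : ∀ n, sigma n S ≤ c * sigma n T) :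
    MemDixmierIdeal S := by
  refine ⟨hS, (IsBigO.of_norm_le fun n => ?_).trans (hT.2.const_mul_left c)⟩
  rw [Real.norm_of_nonneg (sigma_nonneg n S)]
  exact h n

theorem MemDixmierIdeal.add {X Y : H →L[ℂ] H} (hX : MemDixmierIdeal X) (hY : MemDixmierIdeal Y) :
    MemDixmierIdeal (X + Y) := by
  refine ⟨hX.1.add hY.1, (IsBigO.of_norm_le fun n => ?_).trans (hX.2.add hY.2)⟩
  rw [Real.norm_of_nonneg (sigma_nonneg n _)]
  exact sigma_add_le hX.1 hY.1 n

theorem MemDixmierIdeal.smul (c : ℂ) {Z : H →L[ℂ] H} (hZ : MemDixmierIdeal Z) :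
    MemDixmierIdeal (c • Z) :=
  hZ.of_sigma_le (hZ.1.smul c) _ (sigma_smul_le hZ.1 c)

theorem MemDixmierIdeal.real_smul (r : ℝ) {Z : H →L[ℂ] H} (hZ : MemDixmierIdeal Z) :
    MemDixmierIdeal (r • Z) := hZ.smul (r : ℂ)

theorem MemDixmierIdeal.neg {Z : H →L[ℂ] H} (hZ : MemDixmierIdeal Z) : MemDixmierIdeal (-Z) := by
  simpa using hZ.smul (-1)

theorem MemDixmierIdeal.sub {X Y : H →L[ℂ] H} (hX : MemDixmierIdeal X) (hY : MemDixmierIdeal Y) :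
    MemDixmierIdeal (X - Y) := by
  rw [sub_eq_add_neg]
  exact hX.add hY.neg

theorem MemDixmierIdeal.mul_right {Z : H →L[ℂ] H} (hZ : MemDixmierIdeal Z) (B : H →L[ℂ] H) :
    MemDixmierIdeal (Z * B) :=
  hZ.of_sigma_le (hZ.1.comp_clm B) _ (sigma_mul_right_le hZ.1 B)

theorem MemDixmierIdeal.mul_left {Z : H →L[ℂ] H} (hZ : MemDixmierIdeal Z) (B : H →L[ℂ] H) :
    MemDixmierIdeal (B * Z) :=
  hZ.of_sigma_le (hZ.1.clm_comp B) _ (sigma_mul_left_le hZ.1 B)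

theorem isCompactOperator_realPart {Z : H →L[ℂ] H} (hZ : IsCompactOperator Z) :
    IsCompactOperator (ℜ Z : H →L[ℂ] H) := by
  rw [realPart_apply_coe]
  exact (hZ.add (isCompactOperator_adjoint hZ)).smul (2⁻¹ : ℝ)

theorem sigma_realPart_le {Z : H →L[ℂ] H} (hZ : IsCompactOperator Z) (n : ℕ) :
    sigma n (ℜ Z : H →L[ℂ] H) ≤ sigma n Z := by
  have hs := isCompactOperator_adjoint hZ
  have h1 : (ℜ Z : H →L[ℂ] H) = (2⁻¹ : ℂ) • (Z + star Z) := by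
    rw [realPart_apply_coe, ← Complex.coe_smul]
    norm_num
  rw [h1]
  refine (sigma_smul_le (Z := Z + star Z) (hZ.add hs) _ n).trans ?_
  have h2 := sigma_add_le hZ hs n
  have h3 := sigma_star_le hZ n
  norm_num
  linarith

theorem imaginaryPart_eq_realPart (Z : H →L[ℂ] H) :
    (ℑ Z : H →L[ℂ] H) = (ℜ ((-Complex.I) • Z) : H →L[ℂ] H) := by
  rw [neg_smul, ← smul_neg, realPart_I_smul, map_neg, neg_neg]

theorem isCompactOperator_imaginaryPart {Z : H →L[ℂ] H} (hZ : IsCompactOperator Z) :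
    IsCompactOperator (ℑ Z : H →L[ℂ] H) := by
  rw [imaginaryPart_eq_realPart]
  exact isCompactOperator_realPart (hZ.smul (-Complex.I))

theorem sigma_imaginaryPart_le {Z : H →L[ℂ] H} (hZ : IsCompactOperator Z) (n : ℕ) :
    sigma n (ℑ Z : H →L[ℂ] H) ≤ sigma n Z := by
  rw [imaginaryPart_eq_realPart]
  refine (sigma_realPart_le (Z := (-Complex.I) • Z) (hZ.smul (-Complex.I)) n).trans ?_
  simpa using sigma_smul_le hZ (-Complex.I) n

theorem MemDixmierIdeal.realPart {Z : H →L[ℂ] H} (hZ : MemDixmierIdeal Z) :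
    MemDixmierIdeal (ℜ Z : H →L[ℂ] H) :=
  hZ.of_sigma_le (isCompactOperator_realPart hZ.1) 1 fun n => by
    rw [one_mul]; exact sigma_realPart_le hZ.1 n

theorem MemDixmierIdeal.imaginaryPart {Z : H →L[ℂ] H} (hZ : MemDixmierIdeal Z) :
    MemDixmierIdeal (ℑ Z : H →L[ℂ] H) :=
  hZ.of_sigma_le (isCompactOperator_imaginaryPart hZ.1) 1 fun n => by
    rw [one_mul]; exact sigma_imaginaryPart_le hZ.1 n

/-- The vectors `X⁺ x` and `X⁻ x` are orthogonal, so Pythagoras applies to `X x`. -/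
theorem norm_posPart_apply_le {X : H →L[ℂ] H} (hX : IsSelfAdjoint X) (x : H) :
    ‖(X⁺ : H →L[ℂ] H) x‖ ≤ 1 * ‖X x‖ := by
  have h1 : X x = (X⁺ : H →L[ℂ] H) x - (X⁻ : H →L[ℂ] H) x := by
    conv_lhs => rw [← CFC.posPart_sub_negPart X hX]
    rfl
  have hs : IsSelfAdjoint (X⁺ : H →L[ℂ] H) := (CFC.posPart_nonneg X).isSelfAdjoint
  have h2 : inner ℂ ((X⁺ : H →L[ℂ] H) x) ((X⁻ : H →L[ℂ] H) x) = 0 := by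
    rw [← ContinuousLinearMap.adjoint_inner_right, hs.adjoint_eq, ← mul_apply_eq_comp,
      CFC.posPart_mul_negPart, zero_apply, inner_zero_right]
  rw [one_mul, h1]
  refine le_of_pow_le_pow_left₀ two_ne_zero (norm_nonneg _) ?_
  rw [norm_sub_sq (𝕜 := ℂ), h2]
  simp

theorem isCompactOperator_posPart {X : H →L[ℂ] H} (hX : IsSelfAdjoint X)
    (hc : IsCompactOperator X) : IsCompactOperator (X⁺ : H →L[ℂ] H) :=
  isCompactOperator_of_norm_le hc zero_le_one (norm_posPart_apply_le hX)

theorem sigma_posPart_le {X : H →L[ℂ] H} (hX : IsSelfAdjoint X) (hc : IsCompactOperator X)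
    (n : ℕ) : sigma n (X⁺ : H →L[ℂ] H) ≤ sigma n X := by
  simpa using sigma_le_mul hc zero_le_one (norm_posPart_apply_le hX) n

theorem MemDixmierIdeal.posPart {X : H →L[ℂ] H} (hX : IsSelfAdjoint X) (h : MemDixmierIdeal X) :
    MemDixmierIdeal (X⁺ : H →L[ℂ] H) :=
  h.of_sigma_le (isCompactOperator_posPart hX h.1) 1 fun n => by
    rw [one_mul]; exact sigma_posPart_le hX h.1 n

theorem MemDixmierIdeal.negPart {X : H →L[ℂ] H} (hX : IsSelfAdjoint X) (h : MemDixmierIdeal X) :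
    MemDixmierIdeal (X⁻ : H →L[ℂ] H) := by
  rw [← CFC.posPart_neg]
  exact h.neg.posPart hX.neg

/-! ### Trace-class operators -/

theorem IsTraceClass.sigma_le {C : H →L[ℂ] H} (hC : IsTraceClass C) (n : ℕ) :
    sigma n C ≤ traceNorm C :=
  hC.2.sum_le_tsum _ fun _ _ => singularValue_nonneg C _

theorem isTraceClass_of_sigma_le {C : H →L[ℂ] H} (hc : IsCompactOperator C) {M : ℝ}
    (h : ∀ n, sigma n C ≤ M) : IsTraceClass C :=
  ⟨hc, summable_of_sum_range_le (singularValue_nonneg C) h⟩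

theorem IsTraceClass.memDixmierIdeal {C : H →L[ℂ] H} (hC : IsTraceClass C) :
    MemDixmierIdeal C := by
  refine ⟨hC.1, (IsBigO.of_norm_le (g := fun _ : ℕ => traceNorm C) fun n => ?_).trans ?_⟩
  · rw [Real.norm_of_nonneg (sigma_nonneg n C)]
    exact hC.sigma_le n
  · exact (Real.isLittleO_const_log_atTop.comp_tendsto tendsto_natCast_atTop_atTop).isBigO

theorem IsTraceClass.add {X Y : H →L[ℂ] H} (hX : IsTraceClass X) (hY : IsTraceClass Y) :
    IsTraceClass (X + Y) :=
  isTraceClass_of_sigma_le (hX.1.add hY.1) fun n =>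
    (sigma_add_le hX.1 hY.1 n).trans (add_le_add (hX.sigma_le n) (hY.sigma_le n))

/-- The complement `K` of the kernel injects into the range, hence is finite-dimensional. As `F`
vanishes on `Kᗮ`, the minimax bound kills every singular value from index `dim K` on. -/
theorem IsFiniteRank.isTraceClass {F : H →L[ℂ] H} (hF : IsFiniteRank F) : IsTraceClass F := by
  have hfin : FiniteDimensional ℂ (LinearMap.range (F : H →ₗ[ℂ] H)) := hF
  have hclosed : IsClosed (LinearMap.ker (F : H →ₗ[ℂ] H) : Set H) := F.isClosed_ker
  let K : Submodule ℂ H := (LinearMap.ker (F : H →ₗ[ℂ] H))ᗮ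
  have hK : FiniteDimensional ℂ K := by
    refine FiniteDimensional.of_injective
      ((F : H →ₗ[ℂ] H).rangeRestrict ∘ₗ K.subtype) ?_
    rw [← LinearMap.ker_eq_bot, LinearMap.ker_eq_bot']
    intro x hx
    have h1 : F x = 0 := congrArg Subtype.val hx
    have h2 : inner ℂ (x : H) (x : H) = 0 := x.2 x h1
    exact Subtype.ext (inner_self_eq_zero.1 h2)
  refine ⟨hF.isCompactOperator, summable_of_ne_finset_zero (s := Finset.range (Module.finrank ℂ K))
    fun n hn => ?_⟩
  refine le_antisymm (singularValue_le_of_forall_mem_orthogonal hF.isCompactOperator le_rfl K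
    (by simpa using hn) fun x hx => ?_) (singularValue_nonneg F n)
  have : CompleteSpace (LinearMap.ker (F : H →ₗ[ℂ] H)) := hclosed.completeSpace_coe
  rw [Submodule.orthogonal_orthogonal] at hx
  have h1 : F x = 0 := hx
  rw [h1, norm_zero, zero_mul]

/-- Cutting `C` down to its first `N` singular vectors shifts the singular values by at least `N`
places, so the trace norm of the difference is at most a tail of a convergent series. -/
theorem IsTraceClass.exists_isFiniteRank {C : H →L[ℂ] H} (hC : IsTraceClass C) {ε : ℝ}
    (hε : 0 < ε) : ∃ F : H →L[ℂ] H, IsFiniteRank F ∧ IsTraceClass (C - F) ∧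
      traceNorm (C - F) < ε := by
  obtain ⟨e, he⟩ := exists_isSingularSystem hC.1
  obtain ⟨N, hN⟩ := ((tendsto_order.1 (tendsto_sum_nat_add (singularValue C))).2 ε hε).exists
  let V : Submodule ℂ H := Submodule.span ℂ (Set.range fun i : Fin N => e i)
  have hV : FiniteDimensional ℂ V := FiniteDimensional.span_of_finite ℂ (Set.finite_range _)
  let F : H →L[ℂ] H := C * V.starProjection
  have hF : IsFiniteRank F := by
    have h1 : LinearMap.range (F : H →ₗ[ℂ] H) ≤ V.map (C : H →ₗ[ℂ] H) := by
      rintro _ ⟨x, rfl⟩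
      exact ⟨V.starProjection x, V.starProjection_apply_mem x, rfl⟩
    exact Submodule.finiteDimensional_of_le h1
  have hc : IsCompactOperator (C - F) := hC.1.sub (hC.1.comp_clm V.starProjection)
  have hs : ∀ n, singularValue (C - F) n ≤ singularValue C (n + N) := by
    intro n
    have := FiniteDimensional.span_of_finite ℂ (Set.finite_range fun i : Fin n => e (N + i))
    refine singularValue_le_of_forall_mem_orthogonal hc (singularValue_nonneg C _)
      (Submodule.span ℂ (Set.range fun i : Fin n => e (N + i)))
      ((finrank_range_le_card _).trans (Fintype.card_fin n).le) fun x hx => ?_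
    have h1 : (C - F) x = C (x - V.starProjection x) := by
      rw [map_sub]; rfl
    have h2 : x - V.starProjection x = Vᗮ.starProjection x := by
      rw [Submodule.starProjection_orthogonal]; rfl
    have h3 : ‖x - V.starProjection x‖ ≤ ‖x‖ := by
      rw [h2]; exact Submodule.norm_starProjection_apply_le _ _
    rw [h1]
    refine (he.norm_le (n + N) _ fun j hj => ?_).trans
      (mul_le_mul_of_nonneg_left h3 (singularValue_nonneg C _))
    rcases lt_or_ge j N with hjN | hjN
    · rw [h2]
      exact Submodule.inner_right_of_mem_orthogonal
        (Submodule.subset_span ⟨⟨j, hjN⟩, rfl⟩ : e j ∈ V) (Submodule.starProjection_apply_mem _ _)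
    · have h4 : inner ℂ (e j) x = 0 := by
        have := inner_eq_zero_of_mem_orthogonal_span hx ⟨j - N, by omega⟩
        simpa [Nat.add_sub_cancel' hjN] using this
      -- Later singular vectors are orthogonal to `V`, so projecting `V` away from `x` keeps `x`
      -- orthogonal to them.
      have h5 : e j ∈ Vᗮ := by
        rw [Submodule.mem_orthogonal]
        intro u hu
        induction hu using Submodule.span_induction with
        | mem u hu =>
          obtain ⟨i, rfl⟩ := hu
          exact he.orthogonal _ _ (by have := i.2; omega)
        | zero => exact inner_zero_left _
        | add u v _ _ hu hv => rw [inner_add_left, hu, hv, add_zero]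
        | smul c u _ hu => rw [inner_smul_left, hu, mul_zero]
      rw [inner_sub_right, h4, Submodule.inner_left_of_mem_orthogonal
        (Submodule.starProjection_apply_mem V x) h5, sub_zero]
  have hsum : Summable fun n => singularValue C (n + N) := (summable_nat_add_iff N).2 hC.2
  have hsum' := hsum.of_nonneg_of_le (singularValue_nonneg (C - F)) hs
  exact ⟨F, hF, ⟨hc, hsum'⟩, (hsum'.tsum_le_tsum hs hsum).trans_lt hN⟩

theorem isTraceClass_iff {C : H →L[ℂ] H} : IsTraceClass C ↔
    ∀ ε : ℝ, 0 < ε → ∃ F : H →L[ℂ] H, IsFiniteRank F ∧ IsTraceClass (C - F) ∧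
      traceNorm (C - F) < ε := by
  refine ⟨fun h ε hε => h.exists_isFiniteRank hε, fun h => ?_⟩
  obtain ⟨F, hF, hCF, -⟩ := h 1 one_pos
  have := hCF.add hF.isTraceClass
  rwa [sub_add_cancel] at this

end

section

variable {H : Type*} [NormedAddCommGroup H] [InnerProductSpace ℂ H] [CompleteSpace H]
  {ω : StrongDual ℝ LInfty}

/-! ### The Dixmier trace on the positive cone -/

theorem meanFun_nonneg (X : H →L[ℂ] H) (n : ℕ) : 0 ≤ meanFun X n :=
  div_nonneg (sigma_nonneg _ X) (one_add_log_pos n).le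

theorem MemDixmierIdeal.meanFun_le_dixmierNorm {X : H →L[ℂ] H} (hX : MemDixmierIdeal X) (n : ℕ) :
    meanFun X n ≤ dixmierNorm X := by
  refine le_ciSup (f := meanFun X) ?_ n
  obtain ⟨M, hM⟩ := memℓp_infty_iff.1 hX.memℓp_meanFun
  refine ⟨M, ?_⟩
  rintro _ ⟨n, rfl⟩
  exact (le_abs_self _).trans (hM ⟨n, rfl⟩)

theorem MemDixmierIdeal.map_mean_nonneg {X : H →L[ℂ] H} (hX : MemDixmierIdeal X)
    (hω : IsDilationInvariantState ω) : 0 ≤ ω (mean X) :=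
  hω.nonneg _ fun n => by rw [hX.mean_apply]; exact meanFun_nonneg X n

theorem MemDixmierIdeal.map_mean_congr {X Y : H →L[ℂ] H} (hX : MemDixmierIdeal X)
    (hY : MemDixmierIdeal Y) (h : ∀ n, sigma n X = sigma n Y) : ω (mean X) = ω (mean Y) := by
  refine congrArg ω (lp.ext (funext fun n => ?_))
  rw [hX.mean_apply, hY.mean_apply, h]

theorem MemDixmierIdeal.map_mean_smul {X : H →L[ℂ] H} (hX : MemDixmierIdeal X) {a : ℝ}
    (ha : 0 ≤ a) : ω (mean ((a : ℂ) • X)) = a * ω (mean X) := by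
  rw [← smul_eq_mul, ← map_smul]
  refine congrArg ω (lp.ext (funext fun n => ?_))
  rw [(hX.smul a).mean_apply, sigma_smul hX.1, Complex.norm_real, Real.norm_of_nonneg ha,
    lp.coeFn_smul, Pi.smul_apply, hX.mean_apply, smul_eq_mul, mul_div_assoc]

theorem MemDixmierIdeal.map_mean_eq_zero {X : H →L[ℂ] H} (hX : MemDixmierIdeal X)
    (hω : IsDilationInvariantState ω) {M : ℝ} (h : ∀ n, sigma n X ≤ M) : ω (mean X) = 0 := by
  refine le_antisymm ?_ (hX.map_mean_nonneg hω)
  rw [← map_zero ω]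
  refine hω.le_of_le_add (z := fun n => M / (1 + Real.log ((n + 1 : ℕ) : ℝ)))
    (fun n => div_nonneg ((sigma_nonneg 0 X).trans (h 0)) (one_add_log_pos n).le)
    (tendsto_const_div_one_add_log M) fun n => ?_
  rw [hX.mean_apply, lp.coeFn_zero, Pi.zero_apply, zero_add]
  exact div_le_div_of_nonneg_right (h _) (one_add_log_pos n).le

/-- Shifting the index of the mean by one increases it by at most a null sequence. -/
theorem meanFun_succ_le (X : H →L[ℂ] H) (hX : IsCompactOperator X) (n : ℕ) :
    meanFun X (n + 1) ≤ meanFun X n + singularValue X 0 / (1 + Real.log ((n + 1 : ℕ) : ℝ)) := by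
  obtain ⟨e, he⟩ := exists_isSingularSystem hX
  have h1 : singularValue X (n + 1) ≤ singularValue X 0 := he.antitone (Nat.zero_le _)
  have h2 : Real.log ((n + 1 : ℕ) : ℝ) ≤ Real.log ((n + 1 + 1 : ℕ) : ℝ) :=
    Real.log_le_log (by positivity) (by push_cast; linarith)
  rw [meanFun, meanFun, ← add_div]
  refine div_le_div₀ (add_nonneg (sigma_nonneg _ X) (singularValue_nonneg X 0)) ?_
    (one_add_log_pos n) (by linarith)
  rw [sigma_succ (n + 1)]
  linarith

theorem MemDixmierIdeal.map_mean_add {X Y : H →L[ℂ] H} (hX : MemDixmierIdeal X)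
    (hY : MemDixmierIdeal Y) (hX0 : 0 ≤ X) (hY0 : 0 ≤ Y) (hω : IsDilationInvariantState ω) :
    ω (mean (X + Y)) = ω (mean X) + ω (mean Y) := by
  have hXY := hX.add hY
  have hlog := one_add_log_pos
  rw [← map_add]
  refine le_antisymm (hω.mono fun n => ?_) ?_
  · rw [lp.coeFn_add, Pi.add_apply, hX.mean_apply, hY.mean_apply, hXY.mean_apply, ← add_div]
    exact div_le_div_of_nonneg_right (sigma_add_le hX.1 hY.1 _) (hlog n).le
  set M := dixmierNorm (X + Y) with hM
  have hM0 : 0 ≤ M := (meanFun_nonneg _ 0).trans (hXY.meanFun_le_dixmierNorm 0)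
  -- In terms of members counted from one, `c` is the even-numbered subsequence of the means of `X +
  -- Y`.
  let c : LInfty := ⟨fun n => meanFun (X + Y) (2 * n + 1), memℓp_infty ⟨M, by
    rintro _ ⟨n, rfl⟩
    simp only [Real.norm_of_nonneg (meanFun_nonneg (X + Y) _)]
    exact hXY.meanFun_le_dixmierNorm _⟩⟩
  have hc : ∀ n, c n = meanFun (X + Y) (2 * n + 1) := fun n => rfl
  have h1 : ω (mean X + mean Y) ≤ ω c := by
    refine hω.le_of_le_add (z := fun n => (M * Real.log 2) / (1 + Real.log ((n + 1 : ℕ) : ℝ)))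
      (fun n => div_nonneg (mul_nonneg hM0 (Real.log_nonneg one_le_two)) (hlog n).le)
      (tendsto_const_div_one_add_log _) fun n => ?_
    rw [lp.coeFn_add, Pi.add_apply, hX.mean_apply, hY.mean_apply, ← add_div, hc,
      div_le_iff₀ (hlog n), add_mul, div_mul_cancel₀ _ (hlog n).ne']
    -- Doubling the index adds only `ln 2` to the weight, at the cost of the null term `M ln 2 / (1
    -- + ln (n + 1))`.
    have h2 : Real.log ((2 * n + 1 + 1 : ℕ) : ℝ) = Real.log 2 + Real.log ((n + 1 : ℕ) : ℝ) := by
      rw [← Real.log_mul two_ne_zero (by positivity)]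
      congr 1
      push_cast
      ring
    have h3 : meanFun (X + Y) (2 * n + 1) * (1 + Real.log ((2 * n + 1 + 1 : ℕ) : ℝ)) =
        sigma (2 * (n + 1)) (X + Y) := by
      rw [meanFun, div_mul_cancel₀ _ (hlog _).ne']
      rfl
    rw [h2] at h3
    have h4 := sigma_add_sigma_le hX.1 hY.1 hX0 hY0 (n + 1)
    have h5 := mul_le_mul_of_nonneg_right (hXY.meanFun_le_dixmierNorm (2 * n + 1))
      (Real.log_nonneg one_le_two)
    rw [← h3] at h4
    linarith
  refine h1.trans ?_
  rw [← hω.dilation_eq]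
  have hs0 := singularValue_nonneg (X + Y) 0
  refine hω.le_of_le_add
    (z := fun n => singularValue (X + Y) 0 / (1 + Real.log ((n + 1 : ℕ) : ℝ)))
    (fun n => div_nonneg hs0 (hlog n).le) (tendsto_const_div_one_add_log _) fun n => ?_
  have h6 : dilation c n = meanFun (X + Y) (2 * (n / 2) + 1) := rfl
  have h7 : mean (X + Y) n = meanFun (X + Y) n := hXY.mean_apply n
  rw [h6, h7]
  -- At odd `n` the dilated entry is the mean itself; at even `n` it is the next mean, larger by at
  -- most a null term.
  rcases Nat.even_or_odd' n with ⟨k, rfl | rfl⟩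
  · rw [Nat.mul_div_cancel_left k two_pos]
    exact meanFun_succ_le _ hXY.1 _
  · rw [show (2 * k + 1) / 2 = k by omega]
    exact le_add_of_nonneg_right (div_nonneg hs0 (hlog _).le)

/-! ### Linear extension -/

/-- Any difference of positive members may replace the canonical one: apply additivity to both sides
of `(P - Q)⁺ + Q = P + (P - Q)⁻`. -/
theorem dixmierTraceSA_eq_sub (hω : IsDilationInvariantState ω) {P Q : H →L[ℂ] H}
    (hP : MemDixmierIdeal P) (hQ : MemDixmierIdeal Q) (hP0 : 0 ≤ P) (hQ0 : 0 ≤ Q) :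
    dixmierTraceSA ω (P - Q) = ω (mean P) - ω (mean Q) := by
  have hsa : IsSelfAdjoint (P - Q) := hP0.isSelfAdjoint.sub hQ0.isSelfAdjoint
  have hm := hP.sub hQ
  have h1 : (P - Q)⁺ + Q = P + (P - Q)⁻ := by
    have := CFC.posPart_sub_negPart (P - Q) hsa
    rw [sub_eq_sub_iff_add_eq_add] at this
    exact this
  have h2 := (hm.posPart hsa).map_mean_add hQ (CFC.posPart_nonneg _) hQ0 hω
  have h3 := hP.map_mean_add (hm.negPart hsa) hP0 (CFC.negPart_nonneg _) hω
  rw [h1, h3] at h2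
  rw [dixmierTraceSA, dixmierTracePos, dixmierTracePos]
  linarith

theorem dixmierTraceSA_of_nonneg (hω : IsDilationInvariantState ω) {X : H →L[ℂ] H}
    (hX : MemDixmierIdeal X) (hX0 : 0 ≤ X) : dixmierTraceSA ω X = ω (mean X) := by
  have h0 : MemDixmierIdeal (0 : H →L[ℂ] H) := by simpa using hX.smul 0
  have h1 := dixmierTraceSA_eq_sub hω hX h0 hX0 le_rfl
  have h2 := h0.map_mean_smul (ω := ω) (le_refl (0 : ℝ))
  rw [smul_zero, zero_mul] at h2
  rwa [h2, sub_zero, sub_zero] at h1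

theorem dixmierTraceSA_add (hω : IsDilationInvariantState ω) {X Y : H →L[ℂ] H}
    (hX : MemDixmierIdeal X) (hY : MemDixmierIdeal Y) (hXs : IsSelfAdjoint X)
    (hYs : IsSelfAdjoint Y) :
    dixmierTraceSA ω (X + Y) = dixmierTraceSA ω X + dixmierTraceSA ω Y := by
  have h1 : X + Y = (X⁺ + Y⁺) - (X⁻ + Y⁻) := by
    conv_lhs => rw [← CFC.posPart_sub_negPart X hXs, ← CFC.posPart_sub_negPart Y hYs]
    abel
  have hXp := hX.posPart hXs
  have hXn := hX.negPart hXs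
  have hYp := hY.posPart hYs
  have hYn := hY.negPart hYs
  have p1 := CFC.posPart_nonneg X
  have p2 := CFC.posPart_nonneg Y
  have p3 := CFC.negPart_nonneg X
  have p4 := CFC.negPart_nonneg Y
  rw [h1, dixmierTraceSA_eq_sub hω (hXp.add hYp) (hXn.add hYn) (add_nonneg p1 p2)
    (add_nonneg p3 p4), hXp.map_mean_add hYp p1 p2 hω, hXn.map_mean_add hYn p3 p4 hω]
  simp only [dixmierTraceSA, dixmierTracePos]
  ring

theorem dixmierTraceSA_neg {X : H →L[ℂ] H} :
    dixmierTraceSA ω (-X) = -dixmierTraceSA ω X := by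
  rw [dixmierTraceSA, dixmierTraceSA, CFC.posPart_neg, CFC.negPart_neg, neg_sub]

theorem dixmierTraceSA_smul (hω : IsDilationInvariantState ω) {X : H →L[ℂ] H}
    (hX : MemDixmierIdeal X) (hXs : IsSelfAdjoint X) (r : ℝ) :
    dixmierTraceSA ω (r • X) = r * dixmierTraceSA ω X := by
  have key : ∀ a : ℝ, 0 ≤ a → dixmierTraceSA ω (a • X) = a * dixmierTraceSA ω X := by
    intro a ha
    have hXp := hX.posPart hXs
    have hXn := hX.negPart hXs
    have h1 : a • X = a • X⁺ - a • X⁻ := by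
      rw [← smul_sub, CFC.posPart_sub_negPart X hXs]
    rw [h1, dixmierTraceSA_eq_sub hω (hXp.real_smul a) (hXn.real_smul a)
      (smul_nonneg ha (CFC.posPart_nonneg X)) (smul_nonneg ha (CFC.negPart_nonneg X)),
      ← Complex.coe_smul, ← Complex.coe_smul, hXp.map_mean_smul ha, hXn.map_mean_smul ha, ← mul_sub]
    rfl
  rcases le_total 0 r with hr | hr
  · exact key r hr
  · have := key (-r) (neg_nonneg.2 hr)
    rw [neg_smul, dixmierTraceSA_neg] at this
    linarith

theorem dixmierTrace_of_nonneg (hω : IsDilationInvariantState ω) {X : H →L[ℂ] H}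
    (hX : MemDixmierIdeal X) (hX0 : 0 ≤ X) : dixmierTrace ω X = (ω (mean X) : ℂ) := by
  have h0 : MemDixmierIdeal (0 : H →L[ℂ] H) := by simpa using hX.smul 0
  have h1 := dixmierTraceSA_smul hω hX hX0.isSelfAdjoint 0
  rw [zero_smul, zero_mul] at h1
  rw [dixmierTrace, hX0.isSelfAdjoint.coe_realPart, hX0.isSelfAdjoint.imaginaryPart,
    dixmierTraceSA_of_nonneg hω hX hX0, ZeroMemClass.coe_zero, h1]
  simp

theorem dixmierTrace_add (hω : IsDilationInvariantState ω) {Z W : H →L[ℂ] H}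
    (hZ : MemDixmierIdeal Z) (hW : MemDixmierIdeal W) :
    dixmierTrace ω (Z + W) = dixmierTrace ω Z + dixmierTrace ω W := by
  rw [dixmierTrace, map_add, map_add, AddSubgroup.coe_add, AddSubgroup.coe_add,
    dixmierTraceSA_add hω hZ.realPart hW.realPart (ℜ Z).2 (ℜ W).2,
    dixmierTraceSA_add hω hZ.imaginaryPart hW.imaginaryPart (ℑ Z).2 (ℑ W).2, dixmierTrace,
    dixmierTrace]
  push_cast
  ring

theorem dixmierTrace_smul (hω : IsDilationInvariantState ω) {Z : H →L[ℂ] H}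
    (hZ : MemDixmierIdeal Z) (c : ℂ) : dixmierTrace ω (c • Z) = c * dixmierTrace ω Z := by
  have hr := hZ.realPart
  have hi := hZ.imaginaryPart
  have sr : IsSelfAdjoint (ℜ Z : H →L[ℂ] H) := (ℜ Z).2
  have si : IsSelfAdjoint (ℑ Z : H →L[ℂ] H) := (ℑ Z).2
  have h1 : (ℜ (c • Z) : H →L[ℂ] H) = c.re • (ℜ Z : H →L[ℂ] H) + (-c.im) • (ℑ Z : H →L[ℂ] H) := by
    rw [realPart_smul, AddSubgroupClass.coe_sub, selfAdjoint.val_smul, selfAdjoint.val_smul,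
      neg_smul, sub_eq_add_neg]
  have h2 : (ℑ (c • Z) : H →L[ℂ] H) = c.re • (ℑ Z : H →L[ℂ] H) + c.im • (ℜ Z : H →L[ℂ] H) := by
    rw [imaginaryPart_smul, AddSubgroup.coe_add, selfAdjoint.val_smul, selfAdjoint.val_smul]
  rw [dixmierTrace, h1, h2,
    dixmierTraceSA_add hω (hr.real_smul _) (hi.real_smul _) ((IsSelfAdjoint.all _).smul sr)
      ((IsSelfAdjoint.all _).smul si),
    dixmierTraceSA_add hω (hi.real_smul _) (hr.real_smul _) ((IsSelfAdjoint.all _).smul si)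
      ((IsSelfAdjoint.all _).smul sr), dixmierTraceSA_smul hω hr sr, dixmierTraceSA_smul hω hi si,
    dixmierTraceSA_smul hω hr sr, dixmierTraceSA_smul hω hi si, dixmierTrace]
  push_cast
  conv_rhs => rw [← Complex.re_add_im c]
  linear_combination (-c.im * dixmierTraceSA ω (ℑ Z : H →L[ℂ] H) : ℂ) * Complex.I_sq

theorem dixmierTrace_sub (hω : IsDilationInvariantState ω) {Z W : H →L[ℂ] H}
    (hZ : MemDixmierIdeal Z) (hW : MemDixmierIdeal W) :
    dixmierTrace ω (Z - W) = dixmierTrace ω Z - dixmierTrace ω W := by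
  have h1 : Z - W = Z + (-1 : ℂ) • W := by rw [neg_one_smul, sub_eq_add_neg]
  rw [h1, dixmierTrace_add hω hZ (hW.smul _), dixmierTrace_smul hω hW]
  ring

/-! ### The trace property -/

theorem MemDixmierIdeal.exists_nonneg_decomposition {Z : H →L[ℂ] H} (hZ : MemDixmierIdeal Z) :
    ∃ P : Fin 4 → H →L[ℂ] H, (∀ i, 0 ≤ P i ∧ MemDixmierIdeal (P i)) ∧
      Z = (P 0 - P 1) + Complex.I • (P 2 - P 3) := by
  have sr : IsSelfAdjoint (ℜ Z : H →L[ℂ] H) := (ℜ Z).2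
  have si : IsSelfAdjoint (ℑ Z : H →L[ℂ] H) := (ℑ Z).2
  refine ⟨![(ℜ Z : H →L[ℂ] H)⁺, (ℜ Z : H →L[ℂ] H)⁻, (ℑ Z : H →L[ℂ] H)⁺, (ℑ Z : H →L[ℂ] H)⁻],
    fun i => ?_, ?_⟩
  · fin_cases i
    · exact ⟨CFC.posPart_nonneg _, hZ.realPart.posPart sr⟩
    · exact ⟨CFC.negPart_nonneg _, hZ.realPart.negPart sr⟩
    · exact ⟨CFC.posPart_nonneg _, hZ.imaginaryPart.posPart si⟩
    · exact ⟨CFC.negPart_nonneg _, hZ.imaginaryPart.negPart si⟩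
  · have := (realPart_add_I_smul_imaginaryPart Z).symm
    rw [← CFC.posPart_sub_negPart (ℜ Z : H →L[ℂ] H) sr,
      ← CFC.posPart_sub_negPart (ℑ Z : H →L[ℂ] H) si] at this
    exact this

theorem norm_le_one_of_mem_unitary {U : H →L[ℂ] H} (hU : U ∈ unitary (H →L[ℂ] H)) : ‖U‖ ≤ 1 := by
  nontriviality (H →L[ℂ] H)
  exact (CStarRing.norm_of_mem_unitary hU).le

theorem sigma_conj_unitary_le {Z U : H →L[ℂ] H} (hZ : IsCompactOperator Z)
    (hU : U ∈ unitary (H →L[ℂ] H)) (n : ℕ) : sigma n (U * Z * star U) ≤ sigma n Z := by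
  have h1 := norm_le_one_of_mem_unitary hU
  have h2 := norm_le_one_of_mem_unitary (Unitary.star_mem hU)
  refine (sigma_mul_right_le (Z := U * Z) (hZ.clm_comp U) (star U) n).trans ?_
  refine (mul_le_of_le_one_left (sigma_nonneg n _) h2).trans ?_
  exact (sigma_mul_left_le hZ U n).trans (mul_le_of_le_one_left (sigma_nonneg n _) h1)

/-- Conjugation by `U` and by its inverse both fail to increase `sigma n`, so it is preserved. This
settles positive operators, and linearity the rest. -/
theorem dixmierTrace_conj_unitary (hω : IsDilationInvariantState ω) {Z U : H →L[ℂ] H}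
    (hZ : MemDixmierIdeal Z) (hU : U ∈ unitary (H →L[ℂ] H)) :
    dixmierTrace ω (U * Z * star U) = dixmierTrace ω Z := by
  have hm : ∀ {P : H →L[ℂ] H}, MemDixmierIdeal P → MemDixmierIdeal (U * P * star U) :=
    fun hP => (hP.mul_left U).mul_right (star U)
  have key : ∀ P : H →L[ℂ] H, 0 ≤ P ∧ MemDixmierIdeal P →
      dixmierTrace ω (U * P * star U) = dixmierTrace ω P := by
    rintro P ⟨hP0, hP⟩
    rw [dixmierTrace_of_nonneg hω (hm hP) (star_right_conjugate_nonneg hP0 U),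
      dixmierTrace_of_nonneg hω hP hP0, (hm hP).map_mean_congr hP fun n => ?_]
    refine le_antisymm (sigma_conj_unitary_le hP.1 hU n) ?_
    have h1 := sigma_conj_unitary_le (hm hP).1 (Unitary.star_mem hU) n
    have h2 : star U * (U * P * star U) * star (star U) = P := by
      rw [star_star, mul_assoc, mul_assoc, mul_assoc, Unitary.star_mul_self_of_mem hU, mul_one,
        ← mul_assoc, Unitary.star_mul_self_of_mem hU, one_mul]
    rwa [h2] at h1
  obtain ⟨P, hP, rfl⟩ := hZ.exists_nonneg_decomposition
  have h1 : U * ((P 0 - P 1) + Complex.I • (P 2 - P 3)) * star U =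
      (U * P 0 * star U - U * P 1 * star U) +
        Complex.I • (U * P 2 * star U - U * P 3 * star U) := by
    rw [mul_add, add_mul, mul_smul_comm, smul_mul_assoc, mul_sub, sub_mul, mul_sub, sub_mul]
  have hlin : ∀ Q : Fin 4 → H →L[ℂ] H, (∀ i, MemDixmierIdeal (Q i)) →
      dixmierTrace ω ((Q 0 - Q 1) + Complex.I • (Q 2 - Q 3)) =
        (dixmierTrace ω (Q 0) - dixmierTrace ω (Q 1)) +
          Complex.I * (dixmierTrace ω (Q 2) - dixmierTrace ω (Q 3)) := by
    intro Q hQ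
    rw [dixmierTrace_add hω ((hQ 0).sub (hQ 1)) (((hQ 2).sub (hQ 3)).smul _),
      dixmierTrace_smul hω ((hQ 2).sub (hQ 3)), dixmierTrace_sub hω (hQ 0) (hQ 1),
      dixmierTrace_sub hω (hQ 2) (hQ 3)]
  rw [h1, hlin (fun i => U * P i * star U) fun i => hm (hP i).2, hlin P fun i => (hP i).2]
  simp only [key _ (hP _)]

theorem dixmierTrace_mul_comm (hω : IsDilationInvariantState ω) {Z : H →L[ℂ] H}
    (hZ : MemDixmierIdeal Z) (B : H →L[ℂ] H) :
    dixmierTrace ω (Z * B) = dixmierTrace ω (B * Z) := by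
  have hB : B ∈ Submodule.span ℂ (unitary (H →L[ℂ] H) : Set (H →L[ℂ] H)) := by
    rw [CStarAlgebra.span_unitary]; trivial
  induction hB using Submodule.span_induction with
  | mem U hU =>
    -- For unitary `U`, conjugating `Z U` gives `U (Z U) U* = U Z`.
    rw [← dixmierTrace_conj_unitary hω (hZ.mul_right U) hU, mul_assoc, mul_assoc,
      Unitary.mul_star_self_of_mem hU, mul_one]
  | zero => rw [mul_zero, zero_mul]
  | add U V _ _ hU hV =>
    rw [mul_add, add_mul, dixmierTrace_add hω (hZ.mul_right U) (hZ.mul_right V), hU, hV,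
      dixmierTrace_add hω (hZ.mul_left U) (hZ.mul_left V)]
  | smul c U _ hU =>
    rw [mul_smul_comm, smul_mul_assoc, dixmierTrace_smul hω (hZ.mul_right U), hU,
      dixmierTrace_smul hω (hZ.mul_left U)]

/-! ### Trace-class operators and the norm estimate -/

theorem dixmierTraceSA_le_dixmierNorm (hω : IsDilationInvariantState ω) {X Z : H →L[ℂ] H}
    (hX : MemDixmierIdeal X) (hXs : IsSelfAdjoint X) (hZ : MemDixmierIdeal Z)
    (h : ∀ n, sigma n X ≤ sigma n Z) : dixmierTraceSA ω X ≤ dixmierNorm Z := by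
  refine (sub_le_self _ ((hX.negPart hXs).map_mean_nonneg hω)).trans ?_
  refine hω.le_of_le_const fun n => ?_
  rw [(hX.posPart hXs).mean_apply]
  exact (div_le_div_of_nonneg_right ((sigma_posPart_le hXs hX.1 _).trans (h _))
    (one_add_log_pos n).le).trans (hZ.meanFun_le_dixmierNorm n)

theorem dixmierTraceSA_eq_zero (hω : IsDilationInvariantState ω) {X : H →L[ℂ] H}
    (hX : MemDixmierIdeal X) (hXs : IsSelfAdjoint X) {M : ℝ} (h : ∀ n, sigma n X ≤ M) :
    dixmierTraceSA ω X = 0 := by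
  have h1 : ω (mean X⁺) = 0 := (hX.posPart hXs).map_mean_eq_zero hω fun n =>
    (sigma_posPart_le hXs hX.1 n).trans (h n)
  have h2 : ω (mean X⁻) = 0 := (hX.negPart hXs).map_mean_eq_zero hω (M := M) fun n => by
    rw [← CFC.posPart_neg]
    refine (sigma_posPart_le hXs.neg hX.neg.1 n).trans (le_trans ?_ (h n))
    simpa using sigma_smul_le hX.1 (-1) n
  rw [dixmierTraceSA, dixmierTracePos, dixmierTracePos, h1, h2, sub_zero]

theorem IsTraceClass.dixmierTrace_eq_zero (hω : IsDilationInvariantState ω) {C : H →L[ℂ] H}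
    (hC : IsTraceClass C) : dixmierTrace ω C = 0 := by
  have hm := hC.memDixmierIdeal
  rw [dixmierTrace,
    dixmierTraceSA_eq_zero hω hm.realPart (ℜ C).2 fun n =>
      (sigma_realPart_le hC.1 n).trans (hC.sigma_le n),
    dixmierTraceSA_eq_zero hω hm.imaginaryPart (ℑ C).2 fun n =>
      (sigma_imaginaryPart_le hC.1 n).trans (hC.sigma_le n)]
  simp

theorem norm_dixmierTrace_le (hω : IsDilationInvariantState ω) {Z : H →L[ℂ] H}
    (hZ : MemDixmierIdeal Z) : ‖dixmierTrace ω Z‖ ≤ dixmierNorm Z := by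
  -- A phase `c` makes the value real and non-negative, so only the real part of `c • Z` counts and
  -- no constant is lost by estimating two parts separately.
  obtain ⟨c, hc, hcz⟩ := RCLike.exists_norm_eq_mul_self (dixmierTrace ω Z)
  have h1 : dixmierTrace ω (c • Z) = (‖dixmierTrace ω Z‖ : ℂ) := by
    rw [dixmierTrace_smul hω hZ]
    exact hcz.symm
  have h2 : ‖dixmierTrace ω Z‖ = dixmierTraceSA ω (ℜ (c • Z) : H →L[ℂ] H) := by
    have := congrArg Complex.re h1
    rw [Complex.ofReal_re] at this
    rw [← this, dixmierTrace, Complex.add_re, Complex.ofReal_re, Complex.re_mul_ofReal,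
      Complex.I_re, zero_mul, add_zero]
  rw [h2]
  refine dixmierTraceSA_le_dixmierNorm hω (hZ.smul c).realPart (ℜ (c • Z)).2 hZ fun n => ?_
  refine (sigma_realPart_le (hZ.smul c).1 n).trans ?_
  simpa [hc] using sigma_smul_le hZ.1 c n

end

end Dixmier

/-! ### The assembled theorem. -/

theorem proposition3p1 {H : Type*} [NormedAddCommGroup H] [InnerProductSpace ℂ H]
    [CompleteSpace H] [TopologicalSpace.SeparableSpace H] :
    -- dilation-invariant states exist
    (∃ ω : StrongDual ℝ Dixmier.LInfty, Dixmier.IsDilationInvariantState ω) ∧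
    -- Ky Fan inequalities for positive compact operators
    (∀ X Y : H →L[ℂ] H, IsCompactOperator X → IsCompactOperator Y → 0 ≤ X → 0 ≤ Y → ∀ n : ℕ,
      Dixmier.sigma n (X + Y) ≤ Dixmier.sigma n X + Dixmier.sigma n Y ∧
      Dixmier.sigma n X + Dixmier.sigma n Y ≤ Dixmier.sigma (2 * n) (X + Y)) ∧
    -- the Dixmier ideal is a two-sided ideal, and it contains the parts of its members through
    -- which the trace is defined
    (∀ X Y : H →L[ℂ] H, Dixmier.MemDixmierIdeal X → Dixmier.MemDixmierIdeal Y →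
      Dixmier.MemDixmierIdeal (X + Y)) ∧
    (∀ (c : ℂ) (Z : H →L[ℂ] H), Dixmier.MemDixmierIdeal Z → Dixmier.MemDixmierIdeal (c • Z)) ∧
    (∀ Z B : H →L[ℂ] H, Dixmier.MemDixmierIdeal Z →
      Dixmier.MemDixmierIdeal (Z * B) ∧ Dixmier.MemDixmierIdeal (B * Z)) ∧
    (∀ Z : H →L[ℂ] H, Dixmier.MemDixmierIdeal Z →
      Dixmier.MemDixmierIdeal (ℜ Z : H →L[ℂ] H) ∧ Dixmier.MemDixmierIdeal (ℑ Z : H →L[ℂ] H)) ∧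
    (∀ X : H →L[ℂ] H, IsSelfAdjoint X → Dixmier.MemDixmierIdeal X →
      Dixmier.MemDixmierIdeal X⁺ ∧ Dixmier.MemDixmierIdeal X⁻) ∧
    -- trace-class operators belong to the Dixmier ideal, and they form the closure of the
    -- finite-rank operators in the trace norm
    (∀ C : H →L[ℂ] H, Dixmier.IsTraceClass C → Dixmier.MemDixmierIdeal C) ∧
    (∀ C : H →L[ℂ] H, Dixmier.IsTraceClass C ↔
      ∀ ε : ℝ, 0 < ε → ∃ F : H →L[ℂ] H, Dixmier.IsFiniteRank F ∧
        Dixmier.IsTraceClass (C - F) ∧ Dixmier.traceNorm (C - F) < ε) ∧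
    ∀ ω : StrongDual ℝ Dixmier.LInfty, Dixmier.IsDilationInvariantState ω →
      -- on the positive cone: the defining formula, positivity and linearity
      (∀ X : H →L[ℂ] H, 0 ≤ X → Dixmier.MemDixmierIdeal X →
        Dixmier.dixmierTrace ω X = (ω (Dixmier.mean X) : ℂ) ∧ 0 ≤ ω (Dixmier.mean X)) ∧
      (∀ X Y : H →L[ℂ] H, 0 ≤ X → 0 ≤ Y →
        Dixmier.MemDixmierIdeal X → Dixmier.MemDixmierIdeal Y →
        ω (Dixmier.mean (X + Y)) = ω (Dixmier.mean X) + ω (Dixmier.mean Y)) ∧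
      (∀ (a : ℝ) (X : H →L[ℂ] H), 0 ≤ a → 0 ≤ X → Dixmier.MemDixmierIdeal X →
        ω (Dixmier.mean ((a : ℂ) • X)) = a * ω (Dixmier.mean X)) ∧
      -- linearity on the whole ideal
      (∀ (c d : ℂ) (Z W : H →L[ℂ] H), Dixmier.MemDixmierIdeal Z → Dixmier.MemDixmierIdeal W →
        Dixmier.dixmierTrace ω (c • Z + d • W) =
          c * Dixmier.dixmierTrace ω Z + d * Dixmier.dixmierTrace ω W) ∧
      -- the trace property
      (∀ Z B : H →L[ℂ] H, Dixmier.MemDixmierIdeal Z →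
        Dixmier.dixmierTrace ω (Z * B) = Dixmier.dixmierTrace ω (B * Z)) ∧
      -- vanishing on the trace class
      (∀ C : H →L[ℂ] H, Dixmier.IsTraceClass C → Dixmier.dixmierTrace ω C = 0) ∧
      -- the norm estimate and continuity
      (∀ Z : H →L[ℂ] H, Dixmier.MemDixmierIdeal Z →
        ‖Dixmier.dixmierTrace ω Z‖ ≤ Dixmier.dixmierNorm Z) ∧
      (∀ Z : H →L[ℂ] H, Dixmier.MemDixmierIdeal Z → ∀ ε : ℝ, 0 < ε → ∃ δ : ℝ, 0 < δ ∧
        ∀ W : H →L[ℂ] H, Dixmier.MemDixmierIdeal W → Dixmier.dixmierNorm (W - Z) < δ →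
          ‖Dixmier.dixmierTrace ω W - Dixmier.dixmierTrace ω Z‖ < ε) := by
  refine ⟨Dixmier.exists_isDilationInvariantState,
    fun X Y hX hY hX0 hY0 n => ⟨Dixmier.sigma_add_le hX hY n,
      Dixmier.sigma_add_sigma_le hX hY hX0 hY0 n⟩,
    fun X Y hX hY => hX.add hY, fun c Z hZ => hZ.smul c,
    fun Z B hZ => ⟨hZ.mul_right B, hZ.mul_left B⟩,
    fun Z hZ => ⟨hZ.realPart, hZ.imaginaryPart⟩,
    fun X hXs hX => ⟨hX.posPart hXs, hX.negPart hXs⟩,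
    fun C hC => hC.memDixmierIdeal, fun C => Dixmier.isTraceClass_iff, fun ω hω =>
    ⟨fun X hX0 hX => ⟨Dixmier.dixmierTrace_of_nonneg hω hX hX0, hX.map_mean_nonneg hω⟩,
    fun X Y hX0 hY0 hX hY => hX.map_mean_add hY hX0 hY0 hω,
    fun a X ha _ hX => hX.map_mean_smul ha,
    fun c d Z W hZ hW => ?_,
    fun Z B hZ => Dixmier.dixmierTrace_mul_comm hω hZ B,
    fun C hC => hC.dixmierTrace_eq_zero hω,
    fun Z hZ => Dixmier.norm_dixmierTrace_le hω hZ,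
    fun Z hZ ε hε => ⟨ε, hε, fun W hW hWZ => ?_⟩⟩⟩
  · rw [Dixmier.dixmierTrace_add hω (hZ.smul c) (hW.smul d), Dixmier.dixmierTrace_smul hω hZ,
      Dixmier.dixmierTrace_smul hω hW]
  -- By linearity and the norm estimate the trace is 1-Lipschitz, so `δ = ε` serves.
  · rw [← Dixmier.dixmierTrace_sub hω hW hZ]
    exact (Dixmier.norm_dixmierTrace_le hω (hW.sub hZ)).trans_lt hWZ
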